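/- A bargraph (wall polyomino) of area $n$ is a set of $n$ unit cells made of contiguous columns of positive heights $x_1,\dots,x_M$, all base cells being at the same level; it is identified with the composition $(x_1,\dots,x_M)$ of $n$. Its perimeter is the length of its border. All $2^{n-1}$ bargraphs of area $n\ge 1$ are taken equiprobable; let $M_n$ be the number of columns, $x_1^{(n)},\dots,x_{M_n}^{(n)}$ the column heights (put $x_i^{(n)}=0$ for $i>M_n$), and $P_n$ the perimeter of a uniform bargraph of area $n$. Let $x_0,x_1,x_2,\dots$ be i.i.d. Geometric$(1/2)$ variables, $\mathbb P(x_i=k)=2^{-k}$ for $k\ge1$, and put $T_d=|x_d-x_{d-1}|$, $X_m=\sum_{d=1}^m x_d$, $Q_m=\sum_{d=1}^m T_d$. Then: (1) The columns asymptotically correspond to i.i.d. Geometric$(1/2)$ variables, in the following sense. For $1\le m\le n$, conditionally on $M_n=m$, the vector $(x_1^{(n)},\dots,x_m^{(n)})$ has the law of $(x_1,\dots,x_m)$ conditioned on $x_1+\dots+x_m=n$. Moreover, for every sequence $k_n$ of non-negative integers with $(n/2-k_n)/\sqrt n\to\infty$, $$\sup_{A\subseteq\mathbb N^{k_n}}\bigl|\mathbb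 P\bigl((x_1^{(n)},\dots,x_{k_n}^{(n)})\in A\bigr)-\mathbb P\bigl((x_1,\dots,x_{k_n})\in A\bigr)\bigr|\to0\qquad(n\to\infty).$$ (2) For the i.i.d. columns, $\mu_2=\mathbb E(x_d)=2$, $\sigma_x^2=\mathbb V(x_d)=2$, $\mu_3=\mathbb E(T_d)=\tfrac43$, $\sigma_3^2=\mathbb V(T_d)=\tfrac{20}{9}$ and, as $m\to\infty$, $$\frac{\mathbb E(Q_m)}{m}\to\mu_3=\frac43,\quad \frac{\mathbb V(X_m)}{m}\to\sigma_X^2=2,\quad \frac{\mathbb V(Q_m)}{m}\to\sigma_Q^2=\frac{232}{63},\quad \frac{\mathrm{Cov}(X_m,Q_m)}{m}\to C_{X,Q}=\frac{20}{9},$$ the correlation coefficient of $X_m$ and $Q_m$ tends to $\rho_{X,Q}=\frac{5\sqrt2\sqrt{406}}{174}$, and $C_{X,Q}=\mathbb E(x_dT_d)+\mathbb E(x_{d-1}T_d)-2\mu_2\mu_3$. (3) As $n\to\infty$, $\mathbb E(P_n)\sim\frac53 n$, $\mathbb V(P_n)\sim\frac{173}{189}n$, and $$\frac{P_n-\frac53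 n}{\sqrt{173/189}\,\sqrt n}\longrightarrow\mathcal N(0,1)\quad\text{in distribution}.$$ -/

import Mathlib

open MeasureTheory ProbabilityTheory Filter Topology Asymptotics

/-- The perimeter of a finite set of unit cells of the square lattice (a cell is named by the
integer coordinates of its lower left corner): the number of unit lattice edges that separate a
cell of the set from a cell outside of it. -/
def cellPerimeter (S : Finset (ℤ × ℤ)) : ℕ :=
  ∑ q ∈ S, (({(1, 0), (-1, 0), (0, 1), (0, -1)} : Finset (ℤ × ℤ)).filter
    (fun e => q + e ∉ S)).card

/-- The height of column number `i` (counted from `0`) of the bargraph with composition `c`;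
it is `0` to the right of the last column. -/
def bargraphColumn {n : ℕ} (c : Composition n) (i : ℕ) : ℕ := c.blocks.getD i 0

/-- The cells of the bargraph of area `n` whose consecutive column heights are the parts of the
composition `c` of `n`, all base cells being at level `0`. -/
def bargraphCells {n : ℕ} (c : Composition n) : Finset (ℤ × ℤ) :=
  (Finset.range c.length).biUnion fun i =>
    (Finset.range (bargraphColumn c i)).image fun j : ℕ => ((i : ℤ), (j : ℤ))

/-- The perimeter of the bargraph with composition `c`. -/
def bargraphPerimeter {n : ℕ} (c : Composition n) : ℕ := cellPerimeter (bargraphCells c)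

instance compositionMeasurableSpace (n : ℕ) : MeasurableSpace (Composition n) := ⊤

/-- The uniform distribution on the bargraphs of area `n`. -/
noncomputable def bargraphLaw (n : ℕ) : Measure (Composition n) := uniformOn Set.univ

instance bargraphLaw_isProbabilityMeasure (n : ℕ) : IsProbabilityMeasure (bargraphLaw n) :=
  isProbabilityMeasure_uniformOn Set.finite_univ Set.univ_nonempty

/-- The parameter `1/2`. -/
noncomputable def halfParam : unitInterval := ⟨1 / 2, by norm_num, by norm_num⟩

/-- The Geometric(1/2) distribution on `{1, 2, 3, …}`, giving mass `2⁻ᵏ` to `k`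
(`geometricMeasure` is the version that starts at `0`). -/
noncomputable def geomHalf : Measure ℕ := (geometricMeasure halfParam).map Nat.succ

instance geomHalf_isProbabilityMeasure : IsProbabilityMeasure geomHalf :=
  Measure.isProbabilityMeasure_map (Measurable.of_discrete).aemeasurable

/-- The law on `ℕ → ℕ` of a sequence of independent Geometric(1/2) variables; the `i`-th
variable is the coordinate `x i`. -/
noncomputable def geomColumns : Measure (ℕ → ℕ) := Measure.infinitePi fun _ : ℕ => geomHalf

/-- `T_d = |x_d - x_{d-1}|`, here for `d + 1`, `d ≥ 0`. -/
def columnJump (d : ℕ) (x : ℕ → ℕ) : ℝ := |(x (d + 1) : ℝ) - (x d : ℝ)|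

/-- `X_m = x_1 + ⋯ + x_m`. -/
def columnSum (m : ℕ) (x : ℕ → ℕ) : ℝ := ∑ d ∈ Finset.range m, (x (d + 1) : ℝ)

/-- `Q_m = T_1 + ⋯ + T_m`, the vertical perimeter. -/
def jumpSum (m : ℕ) (x : ℕ → ℕ) : ℝ := ∑ d ∈ Finset.range m, columnJump d x

/-!
All three parts rest on the fact that a uniform bargraph can be built by fair coin tosses.

**Columns.** If `a` is a list of `k` heights of total area `s < n`, the bargraphs of area `n` that
begin with `a` are `a` followed by any of the `2 ^ (n - s - 1)` bargraphs of area `n - s`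
(`bargraphLaw_prefix`). So `a` has probability `2⁻¹ ^ s`, exactly as for independent columns, and
the total variation distance of the first `k` columns is at most the probability that `k`
independent columns reach total area `n` (`abs_prefix_sub_le`). This is small by Chebyshev's
inequality. Both conditional laws in the first statement are uniform on the compositions of `n`
into `m` parts (`map_restrict_bargraphLaw`).

**Constants.** A Geometric(1/2) variable `x` satisfies `E f(x) = (f(1) + E f(x + 1)) / 2`
(`integral_geomHalf_eq`), which determines all moments needed, among them the mean distance
`E |x - b| = b - 2 + 4 * 2⁻¹ ^ b`. Jumps that share no column are independent, so the double sums of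
covariances reduce to the diagonal and its neighbours.

**Perimeter.** The perimeter is `2 n + 2 - 2 A`, where `A` is the sum of `min x y - 1` over adjacent
columns (`bargraphPerimeter_eq`). A uniform bargraph of area `n + 2` comes from one of area `n + 1`
by adding, with probability `1/2` each, a cell on top of the first column or a new first column
(`integral_bargraphLaw_succ`). Along this process the first two heights form a Markov chain that
determines the growth of `A`, and explicit bounded solutions of Poisson equations are available:
`A - n / 6 + u` is a martingale with bounded increments `± d`, and `d ^ 2 - 173 / 756` is a
difference `w - E w'` of a bounded function `w` along the chain. Here `u`, `d`, `w` are
`meanCorrector`, `stepSize`, `varCorrector` of the first two heights. The mean and the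
variance of `A` follow at once. For the limit law, the expectation of
`exp (i τ N) (1 - τ ^ 2 w / 2)`, with `N` the martingale, is multiplied in each step by
`exp (- τ ^ 2 σ ^ 2 / 2)` up to an error `O(|τ| ^ 3)`, where `σ ^ 2 = 173 / 756`; with `τ` of order
`1 / √n` the errors of the `n` steps add up to `O(1 / √n)` (`tendsto_charFun_excessMartingale`), and
Lévy's continuity theorem applies.
-/

/-! ### The martingale and its correctors -/

/-- The composition obtained by adding one cell on top of the first column. -/
def raiseHead : List ℕ → List ℕ
  | [] => []
  | x :: l => (x + 1) :: l

/-- The sum of `min x y - 1` over the pairs `x, y` of adjacent columns. -/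
def adjacentExcess : List ℕ → ℝ
  | x :: y :: l => (min x y : ℕ) - 1 + adjacentExcess (y :: l)
  | _ => 0

/-- The bounded corrector `u` that turns `adjacentExcess`, centred, into a martingale; `h` and `p`
are the heights of the first two columns, with `p = 0` if there is only one. The truncated
difference `p - h` makes the first two terms cancel when `p ≤ h`. Up to an additive constant it is
the expected growth of `adjacentExcess`, beyond `1 / 6` per cell, in the rest of the growth
process: `1 - (1 / 2) ^ (p - h)` is the part gained against the second column before the first one is
complete, and the last term comes from the column that will be put in front of the first one. -/
noncomputable def meanCorrector (h p : ℕ) : ℝ :=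
  1 - (1 / 2) ^ (p - h) - 4 / 3 * (1 / 2) ^ h

/-- The size of the martingale increment, as a function of the first two heights. The increment is
`stepSize` when the first column is raised and `-stepSize` when a new column is started. -/
noncomputable def stepSize (h p : ℕ) : ℝ :=
  5 / 6 + 2 / 3 * (1 / 2) ^ h - (1 / 2) ^ (p - h)

/-- A bounded solution of the Poisson equation `varCorrector_poisson` for the squared increment. The
factor `p - h` appears because `(1 / 2) ^ (p - h)` is invariant under raising the first column and
halving; the term with the factor `h` compensates it when a new column is started. -/
noncomputable def varCorrector (h p : ℕ) : ℝ :=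
  4 / 3 - 1 / 3 * (1 / 2) ^ (p - h) - 5 / 3 * (((p - h : ℕ) : ℝ) * (1 / 2) ^ (p - h))
    - ((1 / 2) ^ (p - h)) ^ 2
    + (1 / 2) ^ h * (16 / 9 - 8 / 3 * (1 / 2) ^ (p - h) + 8 / 9 * ((1 / 2) ^ (p - h)) ^ 2)
    - 20 / 9 * ((h : ℝ) * (1 / 2) ^ h) - 28 / 27 * (1 / 2) ^ h - 16 / 21 * ((1 / 2) ^ h) ^ 2

lemma meanCorrector_succ (h p : ℕ) :
    (if h < p then 1 else 0) + meanCorrector (h + 1) p =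
      meanCorrector h p + 1 / 6 + stepSize h p := by
  unfold meanCorrector stepSize
  split_ifs with hp
  · obtain ⟨k, rfl⟩ := Nat.exists_eq_add_of_lt hp
    rw [show h + k + 1 - (h + 1) = k by omega, show h + k + 1 - h = k + 1 by omega]
    ring
  · rw [show p - (h + 1) = 0 by omega, show p - h = 0 by omega]
    ring

lemma meanCorrector_one (h p : ℕ) :
    meanCorrector 1 (h + 1) = meanCorrector (h + 1) p + 1 / 6 - stepSize (h + 1) p := by
  unfold meanCorrector stepSize
  rw [show h + 1 - 1 = h by omega]
  ring

/-- The average of `varCorrector` over the two states that can follow `(h + 1, p)`, namely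
`(h + 2, p)` and `(1, h + 1)`, differs from its present value by the centred squared increment. -/
lemma varCorrector_poisson (h p : ℕ) :
    varCorrector (h + 2) p + varCorrector 1 (h + 1) =
      2 * (varCorrector (h + 1) p - stepSize (h + 1) p ^ 2 + 173 / 756) := by
  unfold varCorrector stepSize
  rw [show h + 1 - 1 = h by omega]
  rcases lt_or_ge (h + 1) p with hp | hp
  · obtain ⟨k, rfl⟩ := Nat.exists_eq_add_of_lt hp
    rw [show h + 1 + k + 1 - (h + 2) = k by omega, show h + 1 + k + 1 - (h + 1) = k + 1 by omega]
    push_cast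
    ring
  · rw [show p - (h + 2) = 0 by omega, show p - (h + 1) = 0 by omega]
    push_cast
    ring

lemma half_pow_mem (n : ℕ) : 0 ≤ (1 / 2 : ℝ) ^ n ∧ (1 / 2 : ℝ) ^ n ≤ 1 :=
  ⟨by positivity, pow_le_one₀ (by norm_num) (by norm_num)⟩

lemma nat_mul_half_pow_mem (n : ℕ) : 0 ≤ (n : ℝ) * (1 / 2) ^ n ∧ (n : ℝ) * (1 / 2) ^ n ≤ 1 := by
  refine ⟨by positivity, ?_⟩
  have : (n : ℝ) ≤ 2 ^ n := by exact_mod_cast Nat.lt_two_pow_self.le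
  rw [one_div, inv_pow, ← div_eq_mul_inv]
  exact (div_le_one (by positivity)).2 this

lemma abs_meanCorrector_le (h p : ℕ) : |meanCorrector h p| ≤ 2 := by
  have h1 := half_pow_mem h
  have h2 := half_pow_mem (p - h)
  unfold meanCorrector
  rw [abs_le]
  constructor <;> linarith

lemma abs_stepSize_le (h p : ℕ) : |stepSize h p| ≤ 2 := by
  have h1 := half_pow_mem h
  have h2 := half_pow_mem (p - h)
  unfold stepSize
  rw [abs_le]
  constructor <;> linarith

lemma abs_varCorrector_le (h p : ℕ) : |varCorrector h p| ≤ 20 := by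
  have h1 := half_pow_mem h
  have h2 := half_pow_mem (p - h)
  have h3 := nat_mul_half_pow_mem h
  have h4 := nat_mul_half_pow_mem (p - h)
  unfold varCorrector
  generalize (1 / 2 : ℝ) ^ h = q at *
  generalize (1 / 2 : ℝ) ^ (p - h) = r at *
  have h5 : 0 ≤ q ^ 2 ∧ q ^ 2 ≤ 1 := ⟨by positivity, pow_le_one₀ h1.1 h1.2⟩
  have h6 : 0 ≤ r ^ 2 ∧ r ^ 2 ≤ 1 := ⟨by positivity, pow_le_one₀ h2.1 h2.2⟩
  have h7 : 0 ≤ q * r ∧ q * r ≤ 1 := ⟨mul_nonneg h1.1 h2.1, mul_le_one₀ h1.2 h2.1 h2.2⟩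
  have h8 : 0 ≤ q * r ^ 2 ∧ q * r ^ 2 ≤ 1 := ⟨mul_nonneg h1.1 h6.1, mul_le_one₀ h1.2 h6.1 h6.2⟩
  rw [abs_le]
  constructor <;> linarith

/-- A function `f` of the first two heights, evaluated at a list of heights; a missing height counts
as `0`. -/
def atHead (f : ℕ → ℕ → ℝ) (l : List ℕ) : ℝ := f (l.getD 0 0) (l.getD 1 0)

/-- The martingale: `adjacentExcess`, centred by a sixth of the area and corrected by
`meanCorrector`. -/
noncomputable def excessMartingale (l : List ℕ) : ℝ :=
  adjacentExcess l + atHead meanCorrector l - (l.sum : ℝ) / 6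

lemma adjacentExcess_raiseHead (x : ℕ) (l : List ℕ) :
    adjacentExcess (raiseHead (x :: l)) =
      adjacentExcess (x :: l) + if x < (x :: l).getD 1 0 then 1 else 0 := by
  cases l with
  | nil => simp [raiseHead, adjacentExcess]
  | cons y l =>
    simp only [raiseHead, adjacentExcess, List.getD_cons_succ, List.getD_cons_zero]
    split_ifs with h
    · rw [min_eq_left (by omega), min_eq_left (by omega)]
      push_cast
      ring
    · rw [min_eq_right (by omega), min_eq_right (by omega)]
      ring

lemma excessMartingale_raiseHead (x : ℕ) (l : List ℕ) :
    excessMartingale (raiseHead (x :: l)) =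
      excessMartingale (x :: l) + atHead stepSize (x :: l) := by
  have h := meanCorrector_succ x ((x :: l).getD 1 0)
  have e : atHead meanCorrector (raiseHead (x :: l)) =
      meanCorrector (x + 1) ((x :: l).getD 1 0) := rfl
  unfold excessMartingale
  rw [adjacentExcess_raiseHead, e]
  simp only [atHead, raiseHead, List.sum_cons, List.getD_cons_zero] at h ⊢
  push_cast
  linarith

lemma excessMartingale_one_cons (x : ℕ) (l : List ℕ) :
    excessMartingale (1 :: (x + 1) :: l) =
      excessMartingale ((x + 1) :: l) - atHead stepSize ((x + 1) :: l) := by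
  have h := meanCorrector_one x (((x + 1) :: l).getD 1 0)
  unfold excessMartingale
  simp only [atHead, List.sum_cons, List.getD_cons_zero, List.getD_cons_succ, adjacentExcess] at h ⊢
  rw [min_eq_left (by omega)]
  push_cast
  linarith

lemma atHead_varCorrector (x : ℕ) (l : List ℕ) :
    atHead varCorrector (raiseHead ((x + 1) :: l)) + atHead varCorrector (1 :: (x + 1) :: l) =
      2 * (atHead varCorrector ((x + 1) :: l) - atHead stepSize ((x + 1) :: l) ^ 2 + 173 / 756) :=
  varCorrector_poisson x _

/-! ### Growing a uniform composition cell by cell -/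

instance compositionDiscrete (n : ℕ) : DiscreteMeasurableSpace (Composition n) :=
  ⟨fun _ => trivial⟩

lemma integrable_bargraphLaw {E : Type*} [NormedAddCommGroup E] {n : ℕ} (F : Composition n → E) :
    Integrable F (bargraphLaw n) :=
  Integrable.of_finite

lemma bargraphLaw_real_singleton {n : ℕ} (c : Composition n) :
    (bargraphLaw n).real {c} = (1 / 2) ^ (n - 1) := by
  classical
  rw [measureReal_def, bargraphLaw, ← Finset.coe_univ, ← Finset.coe_singleton,
    uniformOn_apply_finset]
  simp [composition_card]

lemma integral_bargraphLaw {E : Type*} [NormedAddCommGroup E] [NormedSpace ℝ E] [CompleteSpace E]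
    {n : ℕ} (F : Composition n → E) :
    ∫ c, F c ∂bargraphLaw n = ((1 / 2 : ℝ) ^ (n - 1)) • ∑ c, F c := by
  rw [integral_fintype (integrable_bargraphLaw F), Finset.smul_sum]
  simp_rw [bargraphLaw_real_singleton]

lemma Composition.exists_blocks_eq_cons {n : ℕ} (c : Composition (n + 1)) :
    ∃ x l, c.blocks = (x + 1) :: l := by
  have hs := c.blocks_sum
  have hp : ∀ i ∈ c.blocks, 0 < i := fun i hi => c.blocks_pos hi
  rcases h : c.blocks with _ | ⟨x, l⟩
  · simp [h] at hs
  · have := hp x (by simp [h])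
    exact ⟨x - 1, l, by rw [Nat.sub_add_cancel this]⟩

/-- The two ways of adding a cell to a bargraph of area `n + 1`: on top of the first column, or as
a new first column. -/
def growComposition (n : ℕ) : Composition (n + 1) ⊕ Composition (n + 1) → Composition (n + 2)
  | .inl c => ⟨raiseHead c.blocks, by
      obtain ⟨x, l, h⟩ := c.exists_blocks_eq_cons
      have hp : ∀ i ∈ c.blocks, 0 < i := fun i hi => c.blocks_pos hi
      rw [h] at hp ⊢
      intro i hi
      rcases List.mem_cons.1 hi with rfl | hi
      · omega
      · exact hp i (List.mem_cons_of_mem _ hi), by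
      obtain ⟨x, l, h⟩ := c.exists_blocks_eq_cons
      have hs := c.blocks_sum
      rw [h] at hs ⊢
      simp only [raiseHead, List.sum_cons] at hs ⊢
      omega⟩
  | .inr c => ⟨1 :: c.blocks, by
      intro i hi
      rcases List.mem_cons.1 hi with rfl | hi
      · omega
      · exact c.blocks_pos hi, by
      rw [List.sum_cons, c.blocks_sum]
      omega⟩

lemma growComposition_bijective (n : ℕ) : Function.Bijective (growComposition n) := by
  rw [Fintype.bijective_iff_injective_and_card]
  refine ⟨?_, by simp [composition_card]; ring⟩
  rintro (c | c) (d | d) h <;>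
    obtain ⟨x, l, hc⟩ := c.exists_blocks_eq_cons <;>
    obtain ⟨y, k, hd⟩ := d.exists_blocks_eq_cons <;>
    have h' := congrArg Composition.blocks h <;>
    simp only [growComposition, hc, hd, raiseHead, List.cons.injEq] at h'
  · rw [Sum.inl.injEq]
    ext1
    rw [hc, hd, h'.2, show x = y by omega]
  · omega
  · omega
  · rw [Sum.inr.injEq]
    ext1
    rw [hc, hd, h'.2.1, h'.2.2]

/-- A uniform bargraph of area `n + 2` arises from one of area `n + 1` by choosing one of the two
ways to add a cell with a fair coin. -/
lemma integral_bargraphLaw_succ {E : Type*} [NormedAddCommGroup E] [NormedSpace ℝ E]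
    [CompleteSpace E] (n : ℕ) (F : List ℕ → E) :
    ∫ c, F c.blocks ∂bargraphLaw (n + 2) =
      ∫ c, (1 / 2 : ℝ) • (F (raiseHead c.blocks) + F (1 :: c.blocks)) ∂bargraphLaw (n + 1) := by
  rw [integral_bargraphLaw, integral_bargraphLaw,
    ← (growComposition_bijective n).sum_comp (fun c => F c.blocks), Fintype.sum_sum_type,
    ← Finset.smul_sum, smul_smul, Finset.sum_add_distrib]
  simp only [Nat.add_sub_cancel, growComposition]
  rw [show n + 2 - 1 = n + 1 by omega, pow_succ]

/-! ### First and second moments of the martingale -/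

lemma integral_excessMartingale_succ (n : ℕ) :
    ∫ c, excessMartingale c.blocks ∂bargraphLaw (n + 2) =
      ∫ c, excessMartingale c.blocks ∂bargraphLaw (n + 1) := by
  rw [integral_bargraphLaw_succ]
  congr with c
  obtain ⟨x, l, h⟩ := c.exists_blocks_eq_cons
  rw [h, excessMartingale_raiseHead, excessMartingale_one_cons, smul_eq_mul]
  ring

lemma integral_excessMartingale (n : ℕ) :
    ∫ c, excessMartingale c.blocks ∂bargraphLaw (n + 1) =
      ∫ c, excessMartingale c.blocks ∂bargraphLaw 1 := by
  induction n with
  | zero => rfl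
  | succ n ih => rw [integral_excessMartingale_succ, ih]

lemma integral_excessMartingale_sq_succ (n : ℕ) :
    ∫ c, (excessMartingale c.blocks ^ 2 + atHead varCorrector c.blocks) ∂bargraphLaw (n + 2) =
      ∫ c, (excessMartingale c.blocks ^ 2 + atHead varCorrector c.blocks) ∂bargraphLaw (n + 1)
        + 173 / 756 := by
  rw [integral_bargraphLaw_succ n
    (fun l => excessMartingale l ^ 2 + atHead varCorrector l)]
  have : (173 / 756 : ℝ) = ∫ _, 173 / 756 ∂bargraphLaw (n + 1) := by simp
  rw [this, ← integral_add (integrable_bargraphLaw _) (integrable_bargraphLaw _)]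
  congr with c
  obtain ⟨x, l, h⟩ := c.exists_blocks_eq_cons
  have := atHead_varCorrector x l
  rw [h, excessMartingale_raiseHead, excessMartingale_one_cons, smul_eq_mul]
  linarith

lemma integral_excessMartingale_sq (n : ℕ) :
    ∫ c, (excessMartingale c.blocks ^ 2 + atHead varCorrector c.blocks) ∂bargraphLaw (n + 1) =
      ∫ c, (excessMartingale c.blocks ^ 2 + atHead varCorrector c.blocks) ∂bargraphLaw 1
        + n * (173 / 756) := by
  induction n with
  | zero => simp
  | succ n ih =>
    rw [integral_excessMartingale_sq_succ, ih]
    push_cast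
    ring

/-! ### The characteristic function of the martingale -/

lemma norm_exp_I_mul_sub_le {x : ℝ} (hx : |x| ≤ 1) :
    ‖Complex.exp (x * Complex.I) - (1 + x * Complex.I - x ^ 2 / 2)‖ ≤ |x| ^ 3 := by
  have h := Complex.exp_bound (x := x * Complex.I) (by simpa using hx) (n := 3) (by norm_num)
  have e : ∑ m ∈ Finset.range 3, (x * Complex.I : ℂ) ^ m / (m.factorial : ℂ) =
      1 + x * Complex.I - x ^ 2 / 2 := by
    simp [Finset.sum_range_succ, mul_pow, Nat.factorial]
    ring
  rw [e] at h
  refine h.trans ?_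
  simp only [norm_mul, Complex.norm_real, Complex.norm_I, mul_one, Real.norm_eq_abs]
  norm_num [Nat.factorial]
  nlinarith [pow_nonneg (abs_nonneg x) 3]

lemma norm_exp_I_mul_sub_one_le (x : ℝ) :
    ‖Complex.exp (x * Complex.I) - 1‖ ≤ |x| := by
  rw [mul_comm]
  exact Real.norm_exp_I_mul_ofReal_sub_one_le

lemma abs_exp_neg_sub_le {x : ℝ} (h0 : 0 ≤ x) (h1 : x ≤ 1) :
    |Real.exp (-x) - (1 - x)| ≤ x ^ 2 := by
  have := Real.abs_exp_sub_one_sub_id_le (x := -x) (by rwa [abs_neg, abs_of_nonneg h0])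
  rw [neg_sq] at this
  convert this using 2
  ring

/-- One step of the characteristic function. The Poisson equation `hw` is what makes the terms of
order `τ ^ 2` agree. -/
lemma norm_charFun_step_le {τ d w w₁ w₂ s : ℝ} (hτ : |τ| ≤ 1 / 2) (hd : |d| ≤ 2)
    (hw₀ : |w| ≤ 20) (hw₁ : |w₁| ≤ 20) (hw₂ : |w₂| ≤ 20) (hs₀ : 0 ≤ s) (hs₁ : s ≤ 1)
    (hw : w₁ + w₂ = 2 * (w - d ^ 2 + s)) :
    ‖(1 / 2 : ℂ) * (Complex.exp ((τ * d : ℝ) * Complex.I) * (1 - τ ^ 2 / 2 * w₁) +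
        Complex.exp ((-(τ * d) : ℝ) * Complex.I) * (1 - τ ^ 2 / 2 * w₂)) -
      (Real.exp (-(τ ^ 2 * s / 2)) : ℂ) * (1 - τ ^ 2 / 2 * w)‖ ≤ 40 * |τ| ^ 3 := by
  have ht0 := abs_nonneg τ
  have hx : |τ * d| ≤ 2 * |τ| := by
    rw [abs_mul]
    nlinarith
  have hx1 : |τ * d| ≤ 1 := by linarith
  have hx3 : |τ * d| ^ 3 ≤ 8 * |τ| ^ 3 := by
    calc |τ * d| ^ 3 ≤ (2 * |τ|) ^ 3 := pow_le_pow_left₀ (abs_nonneg _) hx 3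
      _ = 8 * |τ| ^ 3 := by ring
  have R₁ := (norm_exp_I_mul_sub_le hx1).trans hx3
  have hneg : |-(τ * d)| = |τ * d| := abs_neg _
  have R₂ := (norm_exp_I_mul_sub_le (hneg.trans_le hx1)).trans
    ((congrArg (· ^ 3) hneg).trans_le hx3)
  have D₁ := (norm_exp_I_mul_sub_one_le (τ * d)).trans hx
  have D₂ := (norm_exp_I_mul_sub_one_le (-(τ * d))).trans (hneg.trans_le hx)
  have hτ2 : τ ^ 2 = |τ| ^ 2 := (sq_abs τ).symm
  have hτ2' : |τ| ^ 2 ≤ 1 / 4 := by nlinarith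
  have hr : |Real.exp (-(τ ^ 2 * s / 2)) - (1 - τ ^ 2 * s / 2)| ≤ |τ| ^ 3 / 2 := by
    refine (abs_exp_neg_sub_le (by positivity) (by rw [hτ2]; nlinarith)).trans ?_
    have h1 : (τ ^ 2 * s / 2) ^ 2 = |τ| ^ 3 * (|τ| * s ^ 2 / 4) := by rw [hτ2]; ring
    rw [h1, div_eq_mul_inv]
    refine mul_le_mul_of_nonneg_left ?_ (by positivity)
    nlinarith
  set e₁ := Complex.exp ((τ * d : ℝ) * Complex.I)
  set e₂ := Complex.exp ((-(τ * d) : ℝ) * Complex.I)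
  set ρ := Real.exp (-(τ ^ 2 * s / 2))
  have hwC : (w₂ : ℂ) = 2 * (w - d ^ 2 + s) - w₁ := by
    rw [show w₂ = 2 * (w - d ^ 2 + s) - w₁ by linarith]
    push_cast
    ring
  have key : (1 / 2 : ℂ) * (e₁ * (1 - τ ^ 2 / 2 * w₁) + e₂ * (1 - τ ^ 2 / 2 * w₂)) -
      (ρ : ℂ) * (1 - τ ^ 2 / 2 * w) =
      (1 / 2 : ℂ) * (e₁ - (1 + (τ * d : ℝ) * Complex.I - (τ * d : ℝ) ^ 2 / 2)) +
      (1 / 2 : ℂ) * (e₂ - (1 + (-(τ * d) : ℝ) * Complex.I - (-(τ * d) : ℝ) ^ 2 / 2)) +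
      (((-(τ ^ 2 / 4) * w₁ : ℝ) : ℂ) * (e₁ - 1) + ((-(τ ^ 2 / 4) * w₂ : ℝ) : ℂ) * (e₂ - 1)) +
      ((-((ρ - (1 - τ ^ 2 * s / 2)) * (1 - τ ^ 2 / 2 * w)) - τ ^ 4 * s * w / 4 : ℝ) : ℂ) := by
    push_cast
    rw [hwC]
    ring
  have b₁ : ‖((-(τ ^ 2 / 4) * w₁ : ℝ) : ℂ) * (e₁ - 1)‖ ≤ 10 * |τ| ^ 3 := by
    rw [norm_mul, Complex.norm_real, Real.norm_eq_abs, abs_mul, abs_neg,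
      abs_of_nonneg (by positivity : (0 : ℝ) ≤ τ ^ 2 / 4), hτ2]
    calc |τ| ^ 2 / 4 * |w₁| * ‖e₁ - 1‖ ≤ |τ| ^ 2 / 4 * 20 * (2 * |τ|) := by gcongr
      _ = 10 * |τ| ^ 3 := by ring
  have b₂ : ‖((-(τ ^ 2 / 4) * w₂ : ℝ) : ℂ) * (e₂ - 1)‖ ≤ 10 * |τ| ^ 3 := by
    rw [norm_mul, Complex.norm_real, Real.norm_eq_abs, abs_mul, abs_neg,
      abs_of_nonneg (by positivity : (0 : ℝ) ≤ τ ^ 2 / 4), hτ2]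
    calc |τ| ^ 2 / 4 * |w₂| * ‖e₂ - 1‖ ≤ |τ| ^ 2 / 4 * 20 * (2 * |τ|) := by gcongr
      _ = 10 * |τ| ^ 3 := by ring
  have b₃ : ‖((-((ρ - (1 - τ ^ 2 * s / 2)) * (1 - τ ^ 2 / 2 * w)) - τ ^ 4 * s * w / 4 : ℝ) : ℂ)‖ ≤
      10 * |τ| ^ 3 := by
    rw [Complex.norm_real, Real.norm_eq_abs]
    refine (abs_sub _ _).trans ?_
    have h1 : |1 - τ ^ 2 / 2 * w| ≤ 4 := by
      refine (abs_sub _ _).trans ?_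
      rw [abs_one, abs_mul, abs_of_nonneg (by positivity : (0 : ℝ) ≤ τ ^ 2 / 2), hτ2]
      nlinarith [abs_nonneg w]
    have h2 : |τ ^ 4 * s * w / 4| ≤ 5 * |τ| ^ 3 := by
      have : |τ ^ 4 * s * w / 4| = |τ| ^ 3 * (|τ| * s * |w| / 4) := by
        rw [abs_div, abs_mul, abs_mul, abs_pow, abs_of_nonneg hs₀,
          abs_of_nonneg (by norm_num : (0 : ℝ) ≤ 4)]
        ring
      rw [this, mul_comm 5]
      refine mul_le_mul_of_nonneg_left ?_ (by positivity)
      have : |τ| * s * |w| ≤ 1 * 1 * 20 := by gcongr; linarith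
      linarith
    rw [abs_neg, abs_mul]
    have h3 : |ρ - (1 - τ ^ 2 * s / 2)| * |1 - τ ^ 2 / 2 * w| ≤ |τ| ^ 3 / 2 * 4 := by gcongr
    have : 0 ≤ |τ| ^ 3 := by positivity
    linarith
  rw [key]
  refine (norm_add_le _ _).trans ?_
  refine (add_le_add (norm_add_le _ _) le_rfl).trans ?_
  refine (add_le_add (add_le_add (norm_add_le _ _) (norm_add_le _ _)) le_rfl).trans ?_
  rw [norm_mul, norm_mul]
  have : ‖(1 / 2 : ℂ)‖ = 1 / 2 := by norm_num
  rw [this]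
  have : 0 ≤ |τ| ^ 3 := by positivity
  linarith

/-- The characteristic function of `excessMartingale`, corrected to second order so that it
satisfies a geometric recursion up to `O(|τ| ^ 3)`. -/
noncomputable def correctedCharFun (τ : ℝ) (n : ℕ) : ℂ :=
  ∫ c, Complex.exp ((τ * excessMartingale c.blocks : ℝ) * Complex.I) *
    (1 - τ ^ 2 / 2 * atHead varCorrector c.blocks) ∂bargraphLaw n

lemma norm_correctedCharFun_succ_sub_le {τ : ℝ} (hτ : |τ| ≤ 1 / 2) (n : ℕ) :
    ‖correctedCharFun τ (n + 2) -
      (Real.exp (-(τ ^ 2 * (173 / 756) / 2)) : ℂ) * correctedCharFun τ (n + 1)‖ ≤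
      40 * |τ| ^ 3 := by
  unfold correctedCharFun
  rw [integral_bargraphLaw_succ n (fun l => Complex.exp ((τ * excessMartingale l : ℝ) * Complex.I) *
    (1 - τ ^ 2 / 2 * atHead varCorrector l)), ← integral_const_mul,
    ← integral_sub (integrable_bargraphLaw _) (integrable_bargraphLaw _)]
  refine (norm_integral_le_of_norm_le_const (C := 40 * |τ| ^ 3) (ae_of_all _ fun c => ?_)).trans
    (by simp)
  obtain ⟨x, l, h⟩ := c.exists_blocks_eq_cons
  have hstep := norm_charFun_step_le hτ (abs_stepSize_le _ _) (abs_varCorrector_le _ _)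
    (abs_varCorrector_le _ _) (abs_varCorrector_le _ _) (s := 173 / 756) (by norm_num) (by norm_num)
    (atHead_varCorrector x l)
  rw [h, excessMartingale_raiseHead, excessMartingale_one_cons]
  have e₁ : Complex.exp ((τ * (excessMartingale ((x + 1) :: l) +
      atHead stepSize ((x + 1) :: l)) : ℝ) * Complex.I) =
      Complex.exp ((τ * excessMartingale ((x + 1) :: l) : ℝ) * Complex.I) *
      Complex.exp ((τ * atHead stepSize ((x + 1) :: l) : ℝ) * Complex.I) := by
    rw [← Complex.exp_add]
    push_cast
    ring_nf
  have e₂ : Complex.exp ((τ * (excessMartingale ((x + 1) :: l) -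
      atHead stepSize ((x + 1) :: l)) : ℝ) * Complex.I) =
      Complex.exp ((τ * excessMartingale ((x + 1) :: l) : ℝ) * Complex.I) *
      Complex.exp ((-(τ * atHead stepSize ((x + 1) :: l)) : ℝ) * Complex.I) := by
    rw [← Complex.exp_add]
    push_cast
    ring_nf
  rw [e₁, e₂]
  have hn : ‖Complex.exp ((τ * excessMartingale ((x + 1) :: l) : ℝ) * Complex.I)‖ = 1 :=
    Complex.norm_exp_ofReal_mul_I _
  refine (le_of_eq ?_).trans ((mul_le_of_le_one_left (norm_nonneg _) hn.le).trans hstep)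
  rw [← norm_mul]
  congr 1
  rw [Complex.real_smul]
  simp only [atHead]
  push_cast
  ring

lemma norm_correctedCharFun_sub_le {τ : ℝ} (hτ : |τ| ≤ 1 / 2) (n : ℕ) :
    ‖correctedCharFun τ (n + 1) -
      (Real.exp (-(τ ^ 2 * (173 / 756) / 2)) : ℂ) ^ n * correctedCharFun τ 1‖ ≤
      40 * n * |τ| ^ 3 := by
  set ρ := Real.exp (-(τ ^ 2 * (173 / 756) / 2)) with hρ
  have hρ1 : ρ ≤ 1 := by
    rw [hρ, Real.exp_le_one_iff]
    have := sq_nonneg τ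
    linarith
  have hρ0 : 0 ≤ ρ := (Real.exp_pos _).le
  induction n with
  | zero => simp
  | succ n ih =>
    have h := norm_correctedCharFun_succ_sub_le hτ n
    rw [← hρ] at h
    have e : correctedCharFun τ (n + 1 + 1) - (ρ : ℂ) ^ (n + 1) * correctedCharFun τ 1 =
        (correctedCharFun τ (n + 2) - (ρ : ℂ) * correctedCharFun τ (n + 1)) +
        (ρ : ℂ) * (correctedCharFun τ (n + 1) - (ρ : ℂ) ^ n * correctedCharFun τ 1) := by ring
    rw [e]
    refine (norm_add_le _ _).trans ?_
    rw [norm_mul, Complex.norm_real, Real.norm_of_nonneg hρ0]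
    have : ρ * ‖correctedCharFun τ (n + 1) - (ρ : ℂ) ^ n * correctedCharFun τ 1‖ ≤
        1 * (40 * n * |τ| ^ 3) := by gcongr
    push_cast
    linarith

lemma norm_integral_exp_sub_correctedCharFun_le (τ : ℝ) (n : ℕ) :
    ‖∫ c, Complex.exp ((τ * excessMartingale c.blocks : ℝ) * Complex.I) ∂bargraphLaw n -
      correctedCharFun τ n‖ ≤ 10 * τ ^ 2 := by
  unfold correctedCharFun
  rw [← integral_sub (integrable_bargraphLaw _) (integrable_bargraphLaw _)]
  refine (norm_integral_le_of_norm_le_const (C := 10 * τ ^ 2) (ae_of_all _ fun c => ?_)).trans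
    (by simp)
  rw [← mul_one_sub, norm_mul, Complex.norm_exp_ofReal_mul_I, one_mul, sub_sub_cancel]
  have e : (τ ^ 2 / 2 * atHead varCorrector c.blocks : ℂ) =
      ((τ ^ 2 / 2 * atHead varCorrector c.blocks : ℝ) : ℂ) := by push_cast; rfl
  rw [e, Complex.norm_real, Real.norm_eq_abs, abs_mul,
    abs_of_nonneg (by positivity : (0 : ℝ) ≤ τ ^ 2 / 2)]
  have := abs_varCorrector_le (c.blocks.getD 0 0) (c.blocks.getD 1 0)
  calc τ ^ 2 / 2 * |atHead varCorrector c.blocks| ≤ τ ^ 2 / 2 * 20 := by gcongr; exact this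
    _ = 10 * τ ^ 2 := by ring

/-- In area one there is a single bargraph, so the martingale starts deterministically. -/
lemma correctedCharFun_one_tendsto {τ : ℕ → ℝ} (hτ : Tendsto τ atTop (𝓝 0)) :
    Tendsto (fun n => correctedCharFun (τ n) 1) atTop (𝓝 1) := by
  have hc : ∀ t, correctedCharFun t 1 = ∑ c : Composition 1,
      Complex.exp ((t * excessMartingale c.blocks : ℝ) * Complex.I) *
        (1 - t ^ 2 / 2 * atHead varCorrector c.blocks) := by
    intro t
    rw [correctedCharFun, integral_bargraphLaw]
    simp
  have hcont : Continuous fun t => correctedCharFun t 1 := by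
    simp_rw [hc]
    fun_prop
  have h := (hcont.tendsto 0).comp hτ
  have h0 : correctedCharFun 0 1 = 1 := by
    unfold correctedCharFun
    simp
  rw [h0] at h
  exact h

/-- Central limit theorem for the martingale, on the level of characteristic functions. -/
lemma tendsto_charFun_excessMartingale (θ : ℝ) :
    Tendsto (fun n : ℕ =>
      ∫ c, Complex.exp ((θ / √n * excessMartingale c.blocks : ℝ) * Complex.I) ∂bargraphLaw n)
      atTop (𝓝 (Complex.exp (-(θ ^ 2 * (173 / 756) / 2) : ℝ))) := by
  rw [← tendsto_add_atTop_iff_nat 1]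
  set τ : ℕ → ℝ := fun n => θ / √((n + 1 : ℕ) : ℝ) with hτdef
  have hsq : ∀ n : ℕ, τ n ^ 2 = θ ^ 2 / (n + 1) := by
    intro n
    simp only [hτdef]
    rw [div_pow, Real.sq_sqrt (by positivity)]
    push_cast
    rfl
  have hτ : Tendsto τ atTop (𝓝 0) := by
    refine tendsto_const_nhds.div_atTop ?_
    exact Real.tendsto_sqrt_atTop.comp
      (tendsto_natCast_atTop_atTop.comp (tendsto_add_atTop_nat 1))
  have hτabs : Tendsto (fun n => |τ n|) atTop (𝓝 0) := by simpa using hτ.abs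
  have hone := correctedCharFun_one_tendsto hτ
  have hpow : Tendsto (fun n => (Real.exp (-(τ n ^ 2 * (173 / 756) / 2)) : ℂ) ^ n) atTop
      (𝓝 (Complex.exp (-(θ ^ 2 * (173 / 756) / 2) : ℝ))) := by
    have e : ∀ n : ℕ, (Real.exp (-(τ n ^ 2 * (173 / 756) / 2)) : ℂ) ^ n =
        Complex.exp ((-(θ ^ 2 * (173 / 756) / 2) * ((n : ℝ) / (n + 1)) : ℝ)) := by
      intro n
      rw [← Complex.ofReal_pow, ← Real.exp_nat_mul, hsq, Complex.ofReal_exp]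
      congr 2
      field_simp
    simp_rw [e]
    refine (Complex.continuous_exp.tendsto _).comp ((Complex.continuous_ofReal.tendsto _).comp ?_)
    simpa using (tendsto_natCast_div_add_atTop (1 : ℝ)).const_mul (-(θ ^ 2 * (173 / 756) / 2))
  have hmain := hpow.mul hone
  rw [mul_one] at hmain
  have herr : Tendsto (fun n => 10 * τ n ^ 2 + 40 * θ ^ 2 * |τ n|) atTop (𝓝 0) := by
    simpa using ((hτ.pow 2).const_mul 10).add (hτabs.const_mul (40 * θ ^ 2))
  refine hmain.congr_dist (squeeze_zero' (Eventually.of_forall fun _ => dist_nonneg) ?_ herr)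
  have hsmall : ∀ᶠ n in atTop, |τ n| ≤ 1 / 2 :=
    hτabs.eventually_le_const (by norm_num)
  filter_upwards [hsmall] with n hn
  rw [dist_comm, dist_eq_norm, ← sub_add_sub_cancel _ (correctedCharFun (τ n) (n + 1)) _]
  refine (norm_add_le _ _).trans (add_le_add ?_ ?_)
  · exact norm_integral_exp_sub_correctedCharFun_le (τ n) (n + 1)
  · refine (norm_correctedCharFun_sub_le hn n).trans ?_
    have : |τ n| ^ 3 = |τ n| * (θ ^ 2 / (n + 1)) := by rw [← hsq, ← sq_abs (τ n)]; ring
    rw [this]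
    have h2 : (n : ℝ) * (θ ^ 2 / (n + 1)) ≤ θ ^ 2 := by
      rw [mul_div_assoc', div_le_iff₀ (by positivity)]
      nlinarith [sq_nonneg θ]
    nlinarith [abs_nonneg (τ n)]

/-! ### The perimeter in terms of adjacent columns -/

lemma mem_bargraphCells {n : ℕ} {c : Composition n} {q : ℤ × ℤ} :
    q ∈ bargraphCells c ↔ ∃ i j : ℕ, j < bargraphColumn c i ∧ q = ((i : ℤ), (j : ℤ)) := by
  simp only [bargraphCells, Finset.mem_biUnion, Finset.mem_image, Finset.mem_range]
  constructor
  · rintro ⟨i, -, j, hj, rfl⟩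
    exact ⟨i, j, hj, rfl⟩
  · rintro ⟨i, j, hj, rfl⟩
    refine ⟨i, ?_, j, hj, rfl⟩
    by_contra h
    rw [bargraphColumn, List.getD_eq_default _ _ (not_lt.1 h)] at hj
    omega

lemma natCast_mem_bargraphCells {n : ℕ} {c : Composition n} {i j : ℕ} :
    ((i : ℤ), (j : ℤ)) ∈ bargraphCells c ↔ j < bargraphColumn c i := by
  rw [mem_bargraphCells]
  constructor
  · rintro ⟨i', j', h, e⟩
    simp only [Prod.mk.injEq, Nat.cast_inj] at e
    rwa [e.1, e.2]
  · intro h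
    exact ⟨i, j, h, rfl⟩

lemma left_mem_bargraphCells {n : ℕ} {c : Composition n} {i j : ℕ} :
    ((i : ℤ) - 1, (j : ℤ)) ∈ bargraphCells c ↔ j < (0 :: c.blocks).getD i 0 := by
  cases i with
  | zero =>
    rw [mem_bargraphCells]
    simp only [List.getD_cons_zero, not_lt_zero, iff_false]
    rintro ⟨i', j', h, e⟩
    simp only [Prod.mk.injEq] at e
    omega
  | succ i =>
    rw [show ((i + 1 : ℕ) : ℤ) - 1 = (i : ℤ) by push_cast; ring, natCast_mem_bargraphCells,
      List.getD_cons_succ, bargraphColumn]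

lemma below_mem_bargraphCells {n : ℕ} {c : Composition n} {i j : ℕ}
    (hj : j < bargraphColumn c i) :
    ((i : ℤ), (j : ℤ) - 1) ∈ bargraphCells c ↔ 0 < j := by
  cases j with
  | zero =>
    rw [mem_bargraphCells]
    simp only [lt_irrefl, iff_false]
    rintro ⟨i', j', h, e⟩
    simp only [Prod.mk.injEq] at e
    omega
  | succ j =>
    rw [show ((j + 1 : ℕ) : ℤ) - 1 = (j : ℤ) by push_cast; ring, natCast_mem_bargraphCells]
    omega

lemma sum_range_ite_lt (a b : ℕ) :
    ∑ j ∈ Finset.range a, (if j < b then 0 else 1) = a - b := by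
  induction a with
  | zero => simp
  | succ a ih =>
    rw [Finset.sum_range_succ, ih]
    split_ifs <;> omega

lemma sum_range_ite_pos {a : ℕ} (ha : 0 < a) :
    ∑ j ∈ Finset.range a, (if 0 < j then 0 else 1) = 1 := by
  rw [Finset.sum_eq_single_of_mem 0 (Finset.mem_range.2 ha)]
  · simp
  · intro j _ hj
    rw [if_pos (Nat.pos_of_ne_zero hj)]

lemma sum_range_ite_succ_lt {a : ℕ} (ha : 0 < a) :
    ∑ j ∈ Finset.range a, (if j + 1 < a then 0 else 1) = 1 := by
  rw [Finset.sum_eq_single_of_mem (a - 1) (Finset.mem_range.2 (by omega))]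
  · rw [if_neg (by omega)]
  · intro j hj hne
    rw [Finset.mem_range] at hj
    rw [if_pos (by omega)]

/-- Each column contributes its bottom edge, its top edge, and what it exceeds its two neighbours
by. -/
lemma bargraphPerimeter_eq_sum {n : ℕ} (c : Composition n) :
    bargraphPerimeter c = ∑ i ∈ Finset.range c.blocks.length,
      (2 + (c.blocks.getD i 0 - c.blocks.getD (i + 1) 0) +
        (c.blocks.getD i 0 - (0 :: c.blocks).getD i 0)) := by
  rw [bargraphPerimeter, cellPerimeter]
  conv_lhs => rw [bargraphCells]
  rw [Finset.sum_biUnion]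
  · refine Finset.sum_congr rfl fun i hi => ?_
    have hpos : 0 < bargraphColumn c i := by
      rw [Finset.mem_range] at hi
      rw [bargraphColumn, List.getD_eq_getElem _ _ hi]
      exact c.blocks_pos (List.getElem_mem hi)
    rw [Finset.sum_image (by intro a _ b _ h; simpa using h)]
    have h : ∀ j ∈ Finset.range (bargraphColumn c i),
        (({(1, 0), (-1, 0), (0, 1), (0, -1)} : Finset (ℤ × ℤ)).filter
          (fun e => ((i : ℤ), (j : ℤ)) + e ∉ bargraphCells c)).card =
        (if j < bargraphColumn c (i + 1) then 0 else 1) +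
        (if j < (0 :: c.blocks).getD i 0 then 0 else 1) +
        (if j + 1 < bargraphColumn c i then 0 else 1) + (if 0 < j then 0 else 1) := by
      intro j hj
      have h₁ : (((i : ℤ), (j : ℤ)) + (1, 0)) ∈ bargraphCells c ↔
          j < bargraphColumn c (i + 1) := by
        rw [← natCast_mem_bargraphCells]
        simp
      have h₂ : (((i : ℤ), (j : ℤ)) + (-1, 0)) ∈ bargraphCells c ↔
          j < (0 :: c.blocks).getD i 0 := by
        rw [← left_mem_bargraphCells, Prod.mk_add_mk, add_zero, ← sub_eq_add_neg]
      have h₃ : (((i : ℤ), (j : ℤ)) + (0, 1)) ∈ bargraphCells c ↔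
          j + 1 < bargraphColumn c i := by
        rw [← natCast_mem_bargraphCells]
        simp
      have h₄ : (((i : ℤ), (j : ℤ)) + (0, -1)) ∈ bargraphCells c ↔ 0 < j := by
        rw [← below_mem_bargraphCells (Finset.mem_range.1 hj), Prod.mk_add_mk, add_zero,
          ← sub_eq_add_neg]
      rw [Finset.card_filter, Finset.sum_insert (by decide), Finset.sum_insert (by decide),
        Finset.sum_insert (by decide), Finset.sum_singleton]
      simp only [h₁, h₂, h₃, h₄, ite_not, add_assoc]
    refine (Finset.sum_congr rfl h).trans ?_
    rw [Finset.sum_add_distrib, Finset.sum_add_distrib,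
      Finset.sum_add_distrib, sum_range_ite_lt, sum_range_ite_lt, sum_range_ite_succ_lt hpos,
      sum_range_ite_pos hpos]
    simp only [bargraphColumn]
    ring
  · intro a _ b _ hab
    rw [Function.onFun, Finset.disjoint_left]
    simp only [Finset.mem_image, not_exists, not_and]
    rintro q ⟨j, -, rfl⟩ j' - h
    simp only [Prod.mk.injEq, Nat.cast_inj] at h
    exact hab h.1.symm

/-- The contributions of the columns, when a column of height `y` stands to the left of the first
one; `y = 0` is the case of a bargraph. -/
lemma sum_columns_eq (l : List ℕ) (x y : ℕ) :
    ((∑ i ∈ Finset.range (x :: l).length,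
      (2 + ((x :: l).getD i 0 - (x :: l).getD (i + 1) 0) +
        ((x :: l).getD i 0 - (y :: x :: l).getD i 0)) : ℕ) : ℝ) =
      2 * ((x :: l).sum : ℝ) + 2 - 2 * adjacentExcess (x :: l) - (min x y : ℕ) := by
  have hsub : ∀ a b : ℕ, ((a - b : ℕ) : ℝ) = a - (min a b : ℕ) := by
    intro a b
    rw [eq_sub_iff_add_eq]
    exact_mod_cast (by omega : a - b + min a b = a)
  induction l generalizing x y with
  | nil =>
    simp [adjacentExcess, hsub]
    ring
  | cons z l ih =>
    rw [List.length_cons, Finset.sum_range_succ', Nat.cast_add]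
    simp only [List.getD_cons_succ, List.getD_cons_zero]
    have h := ih z x
    simp only [List.getD_cons_succ] at h
    rw [h, Nat.cast_add, Nat.cast_add, hsub, hsub, adjacentExcess, min_comm z x]
    simp only [List.sum_cons]
    push_cast
    ring

/-- The perimeter is an affine function of area and `adjacentExcess`. -/
lemma bargraphPerimeter_eq {n : ℕ} (c : Composition (n + 1)) :
    (bargraphPerimeter c : ℝ) = 2 * (n + 1 : ℕ) + 2 - 2 * adjacentExcess c.blocks := by
  rw [bargraphPerimeter_eq_sum]
  obtain ⟨x, l, h⟩ := c.exists_blocks_eq_cons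
  have hs := c.blocks_sum
  rw [h] at hs ⊢
  rw [sum_columns_eq, hs]
  simp

lemma bargraphPerimeter_sub {n : ℕ} (c : Composition (n + 1)) :
    (bargraphPerimeter c : ℝ) - 5 / 3 * (n + 1 : ℕ) =
      2 - 2 * excessMartingale c.blocks + 2 * atHead meanCorrector c.blocks := by
  rw [bargraphPerimeter_eq, excessMartingale, c.blocks_sum]
  ring

/-! ### Mean, variance and limit law of the perimeter -/

lemma isEquivalent_const_mul_natCast {f : ℕ → ℝ} {a C : ℝ} (ha : a ≠ 0)
    (h : ∀ n : ℕ, |f (n + 1) - a * ((n + 1 : ℕ) : ℝ)| ≤ C * √((n + 1 : ℕ) : ℝ)) :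
    f ~[atTop] fun n => a * (n : ℝ) := by
  have h1 : (fun n : ℕ => f n - a * (n : ℝ)) =O[atTop] fun n : ℕ => √(n : ℝ) := by
    refine IsBigO.of_bound C ?_
    filter_upwards [eventually_ge_atTop 1] with n hn
    obtain ⟨m, rfl⟩ := Nat.exists_eq_add_of_le' hn
    rw [Real.norm_eq_abs, Real.norm_of_nonneg (Real.sqrt_nonneg _)]
    exact h m
  have h2 : (fun n : ℕ => √(n : ℝ)) =o[atTop] fun n : ℕ => (n : ℝ) := by
    refine (isLittleO_of_tendsto' ?_ ?_)
    · filter_upwards [eventually_gt_atTop 0] with n hn h0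
      exact absurd h0 (by positivity)
    · have : Tendsto (fun n : ℕ => (√(n : ℝ))⁻¹) atTop (𝓝 0) :=
        tendsto_inv_atTop_zero.comp (Real.tendsto_sqrt_atTop.comp tendsto_natCast_atTop_atTop)
      refine this.congr fun n => ?_
      rw [Real.sqrt_div_self']
      simp
  exact (h1.trans_isLittleO h2).const_mul_right ha

lemma abs_integral_le_of_abs_le {n : ℕ} {F : Composition n → ℝ} {C : ℝ} (h : ∀ c, |F c| ≤ C) :
    |∫ c, F c ∂bargraphLaw n| ≤ C := by
  have := norm_integral_le_of_norm_le_const (f := F) (μ := bargraphLaw n) (ae_of_all _ h)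
  simpa using this

lemma abs_atHead_meanCorrector_le (l : List ℕ) : |atHead meanCorrector l| ≤ 2 :=
  abs_meanCorrector_le _ _

lemma abs_atHead_varCorrector_le (l : List ℕ) : |atHead varCorrector l| ≤ 20 :=
  abs_varCorrector_le _ _

theorem integral_bargraphPerimeter_isEquivalent :
    (fun n : ℕ => ∫ c, (bargraphPerimeter c : ℝ) ∂(bargraphLaw n))
      ~[atTop] (fun n : ℕ => 5 / 3 * (n : ℝ)) := by
  set m₀ := ∫ c, excessMartingale c.blocks ∂bargraphLaw 1
  refine isEquivalent_const_mul_natCast (C := 6 + 2 * |m₀|) (by norm_num) fun n => ?_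
  have hs : 1 ≤ √((n + 1 : ℕ) : ℝ) := Real.one_le_sqrt.2 (by simp)
  have e : ∫ c, (bargraphPerimeter c : ℝ) ∂bargraphLaw (n + 1) - 5 / 3 * ((n + 1 : ℕ) : ℝ) =
      2 - 2 * m₀ + 2 * ∫ c, atHead meanCorrector c.blocks ∂bargraphLaw (n + 1) := by
    have h1 : ∫ c, (bargraphPerimeter c : ℝ) ∂bargraphLaw (n + 1) - 5 / 3 * ((n + 1 : ℕ) : ℝ) =
        ∫ c, ((bargraphPerimeter c : ℝ) - 5 / 3 * ((n + 1 : ℕ) : ℝ)) ∂bargraphLaw (n + 1) := by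
      rw [integral_sub (integrable_bargraphLaw _) (integrable_bargraphLaw _)]
      simp
    rw [h1]
    simp_rw [bargraphPerimeter_sub]
    rw [integral_add (integrable_bargraphLaw _) (integrable_bargraphLaw _),
      integral_sub (integrable_bargraphLaw _) (integrable_bargraphLaw _), integral_const_mul,
      integral_const_mul, integral_excessMartingale]
    simp [m₀]
  rw [e]
  have hu := abs_integral_le_of_abs_le
    (fun c : Composition (n + 1) => abs_atHead_meanCorrector_le c.blocks)
  have h2 : |2 - 2 * m₀ + 2 * ∫ c, atHead meanCorrector c.blocks ∂bargraphLaw (n + 1)| ≤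
      6 + 2 * |m₀| := by
    have := neg_abs_le m₀
    have := le_abs_self m₀
    rw [abs_le] at hu ⊢
    constructor <;> linarith
  nlinarith [abs_nonneg m₀]

/-- The martingale is of order `√n` in mean; this controls its correlation with the bounded
correctors. -/
lemma integral_abs_excessMartingale_le : ∃ C, ∀ n : ℕ,
    ∫ c, |excessMartingale c.blocks| ∂bargraphLaw (n + 1) ≤ C * √((n + 1 : ℕ) : ℝ) := by
  set a₀ := ∫ c, (excessMartingale c.blocks ^ 2 + atHead varCorrector c.blocks) ∂bargraphLaw 1
    with ha₀
  refine ⟨(|a₀| + 22) / 2, fun n => ?_⟩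
  set s := √((n + 1 : ℕ) : ℝ) with hs
  have hs1 : 1 ≤ s := Real.one_le_sqrt.2 (by simp)
  have hss : s ^ 2 = n + 1 := by
    rw [hs, Real.sq_sqrt (by positivity)]
    push_cast
    rfl
  have h2 : ∫ c, excessMartingale c.blocks ^ 2 ∂bargraphLaw (n + 1) ≤ (|a₀| + 21) * s ^ 2 := by
    have h := integral_excessMartingale_sq n
    rw [integral_add (integrable_bargraphLaw _) (integrable_bargraphLaw _), ← ha₀] at h
    have hw := abs_integral_le_of_abs_le
      (fun c : Composition (n + 1) => abs_atHead_varCorrector_le c.blocks)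
    rw [abs_le] at hw
    have hn : (0 : ℝ) ≤ n := n.cast_nonneg
    have := le_abs_self a₀
    have := abs_nonneg a₀
    rw [hss]
    nlinarith
  -- arithmetic-geometric mean, balanced at the order of magnitude `s` of the martingale
  have h3 : ∫ c, |excessMartingale c.blocks| ∂bargraphLaw (n + 1) ≤
      ∫ c, (excessMartingale c.blocks ^ 2 * (1 / (2 * s)) + s / 2) ∂bargraphLaw (n + 1) := by
    refine integral_mono (integrable_bargraphLaw _) (integrable_bargraphLaw _) fun c => ?_
    simp only
    rw [← sq_abs, mul_one_div, div_add_div _ _ (by positivity) (by norm_num),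
      le_div_iff₀ (by positivity)]
    nlinarith [sq_nonneg (|excessMartingale c.blocks| - s)]
  rw [integral_add (integrable_bargraphLaw _) (integrable_bargraphLaw _), integral_mul_const] at h3
  simp only [integral_const, probReal_univ, smul_eq_mul, one_mul] at h3
  refine h3.trans ?_
  have h4 : (∫ c, excessMartingale c.blocks ^ 2 ∂bargraphLaw (n + 1)) * (1 / (2 * s)) ≤
      (|a₀| + 21) * s ^ 2 * (1 / (2 * s)) := by gcongr
  have h5 : (|a₀| + 21) * s ^ 2 * (1 / (2 * s)) = (|a₀| + 21) / 2 * s := by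
    field_simp
  rw [h5] at h4
  linarith

theorem variance_bargraphPerimeter_isEquivalent :
    (fun n : ℕ => Var[fun c => (bargraphPerimeter c : ℝ); bargraphLaw n])
      ~[atTop] (fun n : ℕ => 173 / 189 * (n : ℝ)) := by
  obtain ⟨C, hC⟩ := integral_abs_excessMartingale_le
  set m₀ := ∫ c, excessMartingale c.blocks ∂bargraphLaw 1 with hm₀
  set a₀ := ∫ c, (excessMartingale c.blocks ^ 2 + atHead varCorrector c.blocks) ∂bargraphLaw 1
    with ha₀
  refine isEquivalent_const_mul_natCast
    (C := 4 * (|a₀| + 25 + 4 * C + (|m₀| + 2) ^ 2)) (by norm_num) fun n => ?_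
  have hs : 1 ≤ √((n + 1 : ℕ) : ℝ) := Real.one_le_sqrt.2 (by simp)
  have hvar : Var[fun c => (bargraphPerimeter c : ℝ); bargraphLaw (n + 1)] =
      4 * (∫ c, (excessMartingale c.blocks - atHead meanCorrector c.blocks) ^ 2
          ∂bargraphLaw (n + 1) -
        (∫ c, (excessMartingale c.blocks - atHead meanCorrector c.blocks)
          ∂bargraphLaw (n + 1)) ^ 2) := by
    have e : (fun c : Composition (n + 1) => (bargraphPerimeter c : ℝ)) = fun c =>
        -2 * (excessMartingale c.blocks - atHead meanCorrector c.blocks) +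
          (5 / 3 * ((n + 1 : ℕ) : ℝ) + 2) := by
      ext c
      linarith [bargraphPerimeter_sub c]
    rw [e, variance_add_const Measurable.of_discrete.aestronglyMeasurable, variance_const_mul,
      variance_eq_sub]
    · simp only [Pi.pow_apply]
      ring
    · rw [memLp_two_iff_integrable_sq Measurable.of_discrete.aestronglyMeasurable]
      exact integrable_bargraphLaw _
  have hmean : |∫ c, (excessMartingale c.blocks - atHead meanCorrector c.blocks)
      ∂bargraphLaw (n + 1)| ≤ |m₀| + 2 := by
    rw [integral_sub (integrable_bargraphLaw _) (integrable_bargraphLaw _),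
      integral_excessMartingale, ← hm₀]
    exact (abs_sub _ _).trans (add_le_add le_rfl (abs_integral_le_of_abs_le
      (fun c : Composition (n + 1) => abs_atHead_meanCorrector_le c.blocks)))
  have hsq : |∫ c, (excessMartingale c.blocks - atHead meanCorrector c.blocks) ^ 2
      ∂bargraphLaw (n + 1) - (a₀ + n * (173 / 756))| ≤ 24 + 4 * (C * √((n + 1 : ℕ) : ℝ)) := by
    rw [ha₀, ← integral_excessMartingale_sq,
      ← integral_sub (integrable_bargraphLaw _) (integrable_bargraphLaw _)]
    calc _ ≤ ∫ c, (24 + 4 * |excessMartingale c.blocks|) ∂bargraphLaw (n + 1) := by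
          refine (Real.norm_eq_abs _).symm.le.trans
            (norm_integral_le_of_norm_le (integrable_bargraphLaw _) (ae_of_all _ fun c => ?_))
          have h1 := abs_atHead_meanCorrector_le c.blocks
          have h2 := abs_atHead_varCorrector_le c.blocks
          have h3 : |excessMartingale c.blocks * atHead meanCorrector c.blocks| ≤
              |excessMartingale c.blocks| * 2 := by
            rw [abs_mul]
            gcongr
          have h4 : atHead meanCorrector c.blocks ^ 2 ≤ 4 := by
            rw [← sq_abs]
            nlinarith [abs_nonneg (atHead meanCorrector c.blocks)]
          have h5 := sq_nonneg (atHead meanCorrector c.blocks)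
          rw [Real.norm_eq_abs]
          rw [abs_le] at h2 h3 ⊢
          constructor <;> nlinarith
      _ ≤ _ := by
          rw [integral_add (integrable_bargraphLaw _) (integrable_bargraphLaw _),
            integral_const_mul]
          simp only [integral_const, probReal_univ, smul_eq_mul, one_mul]
          linarith [hC n]
  rw [hvar]
  have hmean2 : (∫ c, (excessMartingale c.blocks - atHead meanCorrector c.blocks)
      ∂bargraphLaw (n + 1)) ^ 2 ≤ (|m₀| + 2) ^ 2 := by
    rw [← sq_abs]
    gcongr
  have hmean3 := sq_nonneg (∫ c, (excessMartingale c.blocks - atHead meanCorrector c.blocks)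
      ∂bargraphLaw (n + 1))
  have hbig : |a₀| + 25 + (|m₀| + 2) ^ 2 ≤
      (|a₀| + 25 + (|m₀| + 2) ^ 2) * √((n + 1 : ℕ) : ℝ) :=
    le_mul_of_one_le_right (by positivity) hs
  have := le_abs_self a₀
  have := neg_abs_le a₀
  rw [abs_le] at hsq ⊢
  push_cast at hsq hbig ⊢
  constructor <;> linarith

lemma tendsto_charFun_bargraphPerimeter (t : ℝ) :
    Tendsto (fun n : ℕ => ∫ c, Complex.exp
        ((t * (((bargraphPerimeter c : ℝ) - 5 / 3 * (n : ℝ)) / (√(173 / 189) * √(n : ℝ))) : ℝ) *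
          Complex.I) ∂bargraphLaw n)
      atTop (𝓝 (Complex.exp (-(t ^ 2 / 2) : ℝ))) := by
  set σ := √(173 / 189 : ℝ) with hσ
  have hσ0 : 0 < σ := by positivity
  have hσ2 : σ ^ 2 = 173 / 189 := Real.sq_sqrt (by norm_num)
  have hmain := tendsto_charFun_excessMartingale (-2 * t / σ)
  have e : (-2 * t / σ) ^ 2 * (173 / 756) / 2 = t ^ 2 / 2 := by
    rw [div_pow, hσ2]
    ring
  rw [e] at hmain
  have herr : Tendsto (fun n : ℕ => |6 * t / σ| / √(n : ℝ)) atTop (𝓝 0) :=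
    tendsto_const_nhds.div_atTop (Real.tendsto_sqrt_atTop.comp tendsto_natCast_atTop_atTop)
  refine hmain.congr_dist (squeeze_zero' (Eventually.of_forall fun _ => dist_nonneg) ?_ herr)
  filter_upwards [eventually_ge_atTop 1] with n hn
  obtain ⟨m, rfl⟩ := Nat.exists_eq_add_of_le' hn
  rw [dist_comm, dist_eq_norm, ← integral_sub (integrable_bargraphLaw _) (integrable_bargraphLaw _)]
  refine (norm_integral_le_of_norm_le_const (C := |6 * t / σ| / √((m + 1 : ℕ) : ℝ))
    (ae_of_all _ fun c => ?_)).trans (by simp)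
  rw [bargraphPerimeter_sub]
  have hs : 0 < √((m + 1 : ℕ) : ℝ) := by positivity
  set s := √((m + 1 : ℕ) : ℝ)
  have hsplit : Complex.exp ((t * ((2 - 2 * excessMartingale c.blocks +
        2 * atHead meanCorrector c.blocks) / (σ * s)) : ℝ) * Complex.I) -
      Complex.exp ((-2 * t / σ / s * excessMartingale c.blocks : ℝ) * Complex.I) =
      Complex.exp ((-2 * t / σ / s * excessMartingale c.blocks : ℝ) * Complex.I) *
      (Complex.exp ((t / σ / s * (2 + 2 * atHead meanCorrector c.blocks) : ℝ) * Complex.I) - 1) := by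
    rw [mul_sub, mul_one, ← Complex.exp_add, ← add_mul, ← Complex.ofReal_add]
    congr 4
    field_simp
    ring
  rw [hsplit, norm_mul, Complex.norm_exp_ofReal_mul_I, one_mul]
  refine (norm_exp_I_mul_sub_one_le _).trans ?_
  have hu := abs_atHead_meanCorrector_le c.blocks
  have h6 : |2 + 2 * atHead meanCorrector c.blocks| ≤ 6 := by
    rw [abs_le] at hu ⊢
    constructor <;> linarith
  have e6 : |6 * t / σ| / s = |t / σ / s| * 6 := by
    rw [mul_div_assoc, abs_mul, abs_div _ s, abs_of_pos hs, abs_of_pos (by norm_num : (0 : ℝ) < 6)]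
    ring
  rw [abs_mul, e6]
  gcongr

theorem tendstoInDistribution_bargraphPerimeter :
    TendstoInDistribution
      (fun (n : ℕ) (c : Composition n) =>
        ((bargraphPerimeter c : ℝ) - 5 / 3 * (n : ℝ)) / (√(173 / 189) * √(n : ℝ)))
      atTop (fun z : ℝ => z) bargraphLaw (gaussianReal 0 1) where
  forall_aemeasurable n := Measurable.of_discrete.aemeasurable
  tendsto := by
    -- Lévy's continuity theorem
    refine ProbabilityMeasure.tendsto_iff_tendsto_charFun.2 fun t => ?_
    have h := tendsto_charFun_bargraphPerimeter t
    simp only [ProbabilityMeasure.coe_mk, Measure.map_id', charFun_gaussianReal]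
    convert! h using 2 with n
    · rw [charFun_apply_real, integral_map Measurable.of_discrete.aemeasurable (by fun_prop)]
      push_cast
      rfl
    · congr 1
      push_cast
      simp

/-! ### Moments of the Geometric(1/2) distribution -/

lemma halfParam_ne_zero : halfParam ≠ 0 := by
  intro h
  have := congrArg Subtype.val h
  norm_num [halfParam] at this

lemma integrable_geomHalf_iff {f : ℕ → ℝ} :
    Integrable f geomHalf ↔ Summable fun k : ℕ => (1 / 2 : ℝ) ^ (k + 1) * |f (k + 1)| := by
  rw [geomHalf, integrable_map_measure Measurable.of_discrete.aestronglyMeasurable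
    Measurable.of_discrete.aemeasurable, integrable_geometricMeasure_iff halfParam_ne_zero]
  refine summable_congr fun k => ?_
  simp only [halfParam, Function.comp_apply, Real.norm_eq_abs, Nat.succ_eq_add_one]
  ring

lemma hasSum_integral_geomHalf {f : ℕ → ℝ} (hf : Integrable f geomHalf) :
    HasSum (fun k : ℕ => (1 / 2 : ℝ) ^ (k + 1) * f (k + 1)) (∫ k, f k ∂geomHalf) := by
  rw [geomHalf, integral_map Measurable.of_discrete.aemeasurable
    Measurable.of_discrete.aestronglyMeasurable]
  rw [geomHalf, integrable_map_measure Measurable.of_discrete.aestronglyMeasurable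
    Measurable.of_discrete.aemeasurable] at hf
  refine (hasSum_integral_geometricMeasure halfParam_ne_zero hf).congr_fun fun k => ?_
  simp only [halfParam, Function.comp_apply, Nat.succ_eq_add_one, smul_eq_mul]
  ring

lemma integrable_pow_geomHalf (p : ℕ) : Integrable (fun k : ℕ => (k : ℝ) ^ p) geomHalf := by
  rw [integrable_geomHalf_iff]
  have h := summable_pow_mul_geometric_of_norm_lt_one p (r := (1 / 2 : ℝ)) (by norm_num)
  refine ((summable_nat_add_iff 1).2 h).congr fun k => ?_
  rw [abs_of_nonneg (by positivity), mul_comm]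

lemma integrable_natCast_geomHalf : Integrable (fun k : ℕ => (k : ℝ)) geomHalf := by
  simpa using integrable_pow_geomHalf 1

lemma integrable_geomHalf_of_abs_le {f : ℕ → ℝ} {C : ℝ} (h : ∀ k, |f k| ≤ C * (k : ℝ) ^ 2 + C) :
    Integrable f geomHalf := by
  refine (((integrable_pow_geomHalf 2).const_mul C).add (integrable_const C)).mono'
    Measurable.of_discrete.aestronglyMeasurable (ae_of_all _ h)

/-- Memorylessness: a Geometric(1/2) variable is `1` or one more than another such variable, each
with probability `1/2`. -/
lemma integral_geomHalf_eq {f : ℕ → ℝ} (hf : Integrable f geomHalf)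
    (hf' : Integrable (fun k => f (k + 1)) geomHalf) :
    ∫ k, f k ∂geomHalf = (f 1 + ∫ k, f (k + 1) ∂geomHalf) / 2 := by
  have h := hasSum_integral_geomHalf hf
  have h' := (hasSum_integral_geomHalf hf').mul_left (1 / 2)
  have h1 := (hasSum_nat_add_iff' 1).2 h
  have := h1.unique (h'.congr_fun fun k => by ring)
  simp only [Finset.sum_range_one] at this
  norm_num at this
  linarith

lemma integral_natCast_geomHalf : ∫ k, (k : ℝ) ∂geomHalf = 2 := by
  have h := integral_geomHalf_eq integrable_natCast_geomHalf
    (by simpa using integrable_natCast_geomHalf.add (integrable_const (1 : ℝ)))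
  simp only [Nat.cast_add, Nat.cast_one] at h
  rw [integral_add integrable_natCast_geomHalf (integrable_const _)] at h
  simp at h
  linarith

lemma integral_sq_geomHalf : ∫ k, (k : ℝ) ^ 2 ∂geomHalf = 6 := by
  have h2 := integrable_pow_geomHalf 2
  have h1 := integrable_natCast_geomHalf
  have e : (fun k : ℕ => ((k + 1 : ℕ) : ℝ) ^ 2) = fun k : ℕ => (k : ℝ) ^ 2 + (2 * k + 1) := by
    ext k
    push_cast
    ring
  have h3 : Integrable (fun k : ℕ => 2 * (k : ℝ) + 1) geomHalf :=
    (h1.const_mul 2).add (integrable_const _)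
  have h := integral_geomHalf_eq h2 (by rw [e]; exact h2.add h3)
  rw [e, integral_add h2 h3, integral_add (h1.const_mul 2) (integrable_const _),
    integral_const_mul, integral_natCast_geomHalf] at h
  simp at h
  linarith

lemma integrable_half_pow_geomHalf (a : ℕ) :
    Integrable (fun k : ℕ => ((1 / 2 : ℝ) ^ k) ^ a) geomHalf := by
  refine integrable_geomHalf_of_abs_le (C := 1) fun k => ?_
  rw [abs_of_nonneg (by positivity)]
  have := pow_le_one₀ (n := a) (half_pow_mem k).1 (half_pow_mem k).2
  nlinarith [sq_nonneg (k : ℝ)]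

lemma integrable_mul_half_pow_geomHalf :
    Integrable (fun k : ℕ => (k : ℝ) * (1 / 2 : ℝ) ^ k) geomHalf := by
  refine integrable_geomHalf_of_abs_le (C := 1) fun k => ?_
  rw [abs_of_nonneg (by positivity)]
  have := (nat_mul_half_pow_mem k).2
  nlinarith [sq_nonneg (k : ℝ)]

lemma integral_half_pow_geomHalf : ∫ k, (1 / 2 : ℝ) ^ k ∂geomHalf = 1 / 3 := by
  have h1 := integrable_half_pow_geomHalf 1
  simp only [pow_one] at h1
  have e : (fun k : ℕ => (1 / 2 : ℝ) ^ (k + 1)) = fun k : ℕ => 1 / 2 * (1 / 2 : ℝ) ^ k := by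
    ext k
    ring
  have h := integral_geomHalf_eq h1 (by rw [e]; exact h1.const_mul _)
  rw [e, integral_const_mul] at h
  linarith

lemma integral_half_pow_sq_geomHalf : ∫ k, ((1 / 2 : ℝ) ^ k) ^ 2 ∂geomHalf = 1 / 7 := by
  have h1 := integrable_half_pow_geomHalf 2
  have e : (fun k : ℕ => ((1 / 2 : ℝ) ^ (k + 1)) ^ 2) =
      fun k : ℕ => 1 / 4 * ((1 / 2 : ℝ) ^ k) ^ 2 := by
    ext k
    ring
  have h := integral_geomHalf_eq h1 (by rw [e]; exact h1.const_mul _)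
  rw [e, integral_const_mul] at h
  linarith

lemma integral_mul_half_pow_geomHalf : ∫ k, (k : ℝ) * (1 / 2 : ℝ) ^ k ∂geomHalf = 4 / 9 := by
  have h1 := integrable_half_pow_geomHalf 1
  simp only [pow_one] at h1
  have h2 := integrable_mul_half_pow_geomHalf
  have e : (fun k : ℕ => ((k + 1 : ℕ) : ℝ) * (1 / 2 : ℝ) ^ (k + 1)) =
      fun k : ℕ => 1 / 2 * ((k : ℝ) * (1 / 2 : ℝ) ^ k) + 1 / 2 * (1 / 2 : ℝ) ^ k := by
    ext k
    push_cast
    ring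
  have h := integral_geomHalf_eq h2 (by rw [e]; exact (h2.const_mul _).add (h1.const_mul _))
  rw [e, integral_add (h2.const_mul _) (h1.const_mul _), integral_const_mul, integral_const_mul,
    integral_half_pow_geomHalf] at h
  norm_num at h
  linarith

/-- The mean distance of a Geometric(1/2) variable to `b`. -/
noncomputable def meanDist (b : ℕ) : ℝ := b - 2 + 4 * (1 / 2) ^ b

lemma integrable_abs_sub_geomHalf (b : ℕ) : Integrable (fun k : ℕ => |(k : ℝ) - b|) geomHalf :=
  (integrable_natCast_geomHalf.sub (integrable_const _)).abs

lemma integral_abs_sub_geomHalf (b : ℕ) : ∫ k, |(k : ℝ) - b| ∂geomHalf = meanDist b := by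
  induction b with
  | zero =>
    have : ∀ k : ℕ, |(k : ℝ) - (0 : ℕ)| = k := fun k => by simp
    simp_rw [this]
    rw [integral_natCast_geomHalf, meanDist]
    norm_num
  | succ b ih =>
    have e : (fun k : ℕ => |((k + 1 : ℕ) : ℝ) - (b + 1 : ℕ)|) = fun k : ℕ => |(k : ℝ) - b| := by
      ext k
      push_cast
      ring_nf
    have h := integral_geomHalf_eq (integrable_abs_sub_geomHalf (b + 1))
      (by rw [e]; exact integrable_abs_sub_geomHalf b)
    rw [e, ih] at h
    rw [h]
    have : |((1 : ℕ) : ℝ) - (b + 1 : ℕ)| = b := by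
      rw [abs_sub_comm]
      push_cast
      rw [add_sub_cancel_right, abs_of_nonneg (by positivity)]
    rw [this, meanDist, meanDist]
    push_cast
    ring

lemma integral_meanDist : ∫ b, meanDist b ∂geomHalf = 4 / 3 := by
  have h1 := integrable_half_pow_geomHalf 1
  simp only [pow_one] at h1
  have h2 : Integrable (fun b : ℕ => (b : ℝ) - 2) geomHalf :=
    integrable_natCast_geomHalf.sub (integrable_const _)
  unfold meanDist
  rw [integral_add h2 (h1.const_mul _),
    integral_sub integrable_natCast_geomHalf (integrable_const _), integral_const_mul,
    integral_natCast_geomHalf, integral_half_pow_geomHalf]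
  simp
  norm_num

lemma integral_mul_meanDist : ∫ b, (b : ℝ) * meanDist b ∂geomHalf = 34 / 9 := by
  have h1 := integrable_natCast_geomHalf.const_mul 2
  have h2 := integrable_pow_geomHalf 2
  have h3 := integrable_mul_half_pow_geomHalf.const_mul 4
  have h4 : Integrable (fun b : ℕ => (b : ℝ) ^ 2 - 2 * b) geomHalf := h2.sub h1
  have e : (fun b : ℕ => (b : ℝ) * meanDist b) =
      fun b : ℕ => (b : ℝ) ^ 2 - 2 * b + 4 * ((b : ℝ) * (1 / 2) ^ b) := by
    ext b
    rw [meanDist]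
    ring
  rw [e, integral_add h4 h3, integral_sub h2 h1, integral_const_mul, integral_const_mul,
    integral_natCast_geomHalf, integral_sq_geomHalf, integral_mul_half_pow_geomHalf]
  norm_num

lemma integral_meanDist_sq : ∫ b, meanDist b ^ 2 ∂geomHalf = 158 / 63 := by
  have h0 := integrable_half_pow_geomHalf 1
  simp only [pow_one] at h0
  have h1 := integrable_natCast_geomHalf.const_mul 4
  have h2 := integrable_pow_geomHalf 2
  have h3 := integrable_mul_half_pow_geomHalf.const_mul 8
  have h4 := (integrable_half_pow_geomHalf 2).const_mul 16
  have h5 := h0.const_mul 16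
  have h6 : Integrable (fun _ : ℕ => (4 : ℝ)) geomHalf := integrable_const _
  have e : (fun b : ℕ => meanDist b ^ 2) =
      fun b : ℕ => ((b : ℝ) ^ 2 + 4 + 8 * ((b : ℝ) * (1 / 2) ^ b) + 16 * ((1 / 2) ^ b) ^ 2) -
        (4 * b + 16 * (1 / 2) ^ b) := by
    ext b
    rw [meanDist]
    ring
  rw [e, integral_sub (((h2.fun_add h6).fun_add h3).fun_add h4) (h1.fun_add h5),
    integral_add ((h2.fun_add h6).fun_add h3) h4, integral_add (h2.fun_add h6) h3,
    integral_add h2 h6, integral_add h1 h5]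
  simp only [integral_const_mul]
  rw [integral_natCast_geomHalf, integral_sq_geomHalf, integral_mul_half_pow_geomHalf,
    integral_half_pow_geomHalf, integral_half_pow_sq_geomHalf]
  simp
  norm_num

/-! ### Independent columns: means, variances and covariances -/

instance geomColumns_isProbabilityMeasure : IsProbabilityMeasure geomColumns := by
  unfold geomColumns
  infer_instance

lemma iIndepFun_columns : iIndepFun (fun (i : ℕ) (x : ℕ → ℕ) => x i) geomColumns :=
  iIndepFun_infinitePi (X := fun _ k => k) fun _ => measurable_id

lemma measurePreserving_column (d : ℕ) :
    MeasurePreserving (fun x : ℕ → ℕ => x d) geomColumns geomHalf :=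
  measurePreserving_eval_infinitePi _ d

lemma integral_column (d : ℕ) (f : ℕ → ℝ) :
    ∫ x, f (x d) ∂geomColumns = ∫ k, f k ∂geomHalf := by
  rw [← (measurePreserving_column d).map_eq, integral_map (measurable_pi_apply d).aemeasurable
    Measurable.of_discrete.aestronglyMeasurable]

lemma memLp_column (d : ℕ) : MemLp (fun x : ℕ → ℕ => (x d : ℝ)) 2 geomColumns := by
  have h : MemLp (fun k : ℕ => (k : ℝ)) 2 geomHalf :=
    (memLp_two_iff_integrable_sq Measurable.of_discrete.aestronglyMeasurable).2
      (integrable_pow_geomHalf 2)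
  exact h.comp_measurePreserving (measurePreserving_column d)

lemma memLp_columnJump (d : ℕ) : MemLp (columnJump d) 2 geomColumns :=
  ((memLp_column (d + 1)).sub (memLp_column d)).abs

lemma integral_column_pair {i j : ℕ} (hij : i ≠ j) {F : ℕ → ℕ → ℝ}
    (hF : Integrable (fun x => F (x i) (x j)) geomColumns) :
    ∫ x, F (x i) (x j) ∂geomColumns = ∫ a, ∫ b, F a b ∂geomHalf ∂geomHalf := by
  have hmap : geomColumns.map (fun x => (x i, x j)) = geomHalf.prod geomHalf :=
    Measure.infinitePi_map_eval_prod hij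
  have hm : AEMeasurable (fun x : ℕ → ℕ => (x i, x j)) geomColumns := by fun_prop
  have hFm : AEStronglyMeasurable (fun p : ℕ × ℕ => F p.1 p.2)
      (geomColumns.map fun x => (x i, x j)) :=
    Measurable.of_discrete.aestronglyMeasurable
  have h := integral_map hm hFm
  have hint := (integrable_map_measure hFm hm).2 hF
  rw [hmap] at h hint
  rw [← h, integral_prod _ hint]

lemma integral_column_triple {i j k : ℕ} (hij : i ≠ j) (hik : i ≠ k) (hjk : j ≠ k)
    {F : ℕ → ℕ → ℕ → ℝ} (hF : Integrable (fun x => F (x i) (x j) (x k)) geomColumns) :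
    ∫ x, F (x i) (x j) (x k) ∂geomColumns =
      ∫ a, ∫ b, ∫ c, F a b c ∂geomHalf ∂geomHalf ∂geomHalf := by
  have hmap : geomColumns.map (fun x => ((x i, x j), x k)) =
      (geomHalf.prod geomHalf).prod geomHalf := by
    rw [(iIndepFun_columns.indepFun_prodMk (fun i => measurable_pi_apply i) i j k hik
      hjk).map_prod_eq_prod_map_map (by fun_prop) (measurable_pi_apply k).aemeasurable,
      (measurePreserving_column k).map_eq]
    congr 1
    exact Measure.infinitePi_map_eval_prod hij
  have hm : AEMeasurable (fun x : ℕ → ℕ => ((x i, x j), x k)) geomColumns := by fun_prop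
  have hFm : AEStronglyMeasurable (fun p : (ℕ × ℕ) × ℕ => F p.1.1 p.1.2 p.2)
      (geomColumns.map fun x => ((x i, x j), x k)) :=
    Measurable.of_discrete.aestronglyMeasurable
  have h := integral_map hm hFm
  have hint := (integrable_map_measure hFm hm).2 hF
  rw [hmap] at h hint
  rw [← h, integral_prod _ hint, integral_prod _ hint.integral_prod_left]

lemma integral_column_eq_two (d : ℕ) : ∫ x, (x d : ℝ) ∂geomColumns = 2 := by
  rw [integral_column d (fun k => (k : ℝ)), integral_natCast_geomHalf]

lemma variance_column (d : ℕ) : Var[fun x => (x d : ℝ); geomColumns] = 2 := by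
  rw [variance_eq_sub (memLp_column d), integral_column_eq_two]
  simp only [Pi.pow_apply]
  rw [integral_column d (fun k => (k : ℝ) ^ 2), integral_sq_geomHalf]
  norm_num

lemma covariance_column_of_ne {i j : ℕ} (hij : i ≠ j) :
    cov[fun x => (x i : ℝ), fun x => (x j : ℝ); geomColumns] = 0 := by
  have h : IndepFun (fun x : ℕ → ℕ => (x i : ℝ)) (fun x : ℕ → ℕ => (x j : ℝ)) geomColumns :=
    (iIndepFun_columns.indepFun hij).comp (φ := fun k : ℕ => (k : ℝ)) (ψ := fun k : ℕ => (k : ℝ))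
      Measurable.of_discrete Measurable.of_discrete
  exact h.covariance_eq_zero (memLp_column i) (memLp_column j)

lemma integral_columnJump (d : ℕ) : ∫ x, columnJump d x ∂geomColumns = 4 / 3 := by
  have h := integral_column_pair (i := d) (j := d + 1) (by omega)
    (F := fun a b => |(b : ℝ) - a|) ((memLp_columnJump d).integrable (by norm_num))
  simp_rw [integral_abs_sub_geomHalf] at h
  rw [integral_meanDist] at h
  exact h

lemma integral_columnJump_sq (d : ℕ) : ∫ x, columnJump d x ^ 2 ∂geomColumns = 4 := by
  have h1 := (memLp_column (d + 1)).integrable_sq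
  have h2 := (memLp_column d).integrable_sq
  have h3 : Integrable (fun x : ℕ → ℕ => (x (d + 1) : ℝ) * (x d : ℝ)) geomColumns :=
    (memLp_column (d + 1)).integrable_mul (memLp_column d)
  have h4 := covariance_eq_sub (memLp_column (d + 1)) (memLp_column d)
  rw [covariance_column_of_ne (by omega), integral_column_eq_two, integral_column_eq_two] at h4
  simp only [Pi.mul_apply] at h4
  have e : (fun x => columnJump d x ^ 2) = fun x : ℕ → ℕ =>
      (x (d + 1) : ℝ) ^ 2 + (x d : ℝ) ^ 2 - 2 * ((x (d + 1) : ℝ) * (x d : ℝ)) := by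
    ext x
    rw [columnJump, sq_abs]
    ring
  rw [e, integral_sub (h1.fun_add h2) (h3.const_mul 2), integral_add h1 h2, integral_const_mul,
    integral_column (d + 1) (fun k => (k : ℝ) ^ 2), integral_column d (fun k => (k : ℝ) ^ 2),
    integral_sq_geomHalf]
  linarith

lemma variance_columnJump (d : ℕ) : Var[columnJump d; geomColumns] = 20 / 9 := by
  rw [variance_eq_sub (memLp_columnJump d), integral_columnJump]
  simp only [Pi.pow_apply]
  rw [integral_columnJump_sq]
  norm_num

lemma integral_column_mul_columnJump (d : ℕ) :
    ∫ x, (x d : ℝ) * columnJump d x ∂geomColumns = 34 / 9 := by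
  have h := integral_column_pair (i := d) (j := d + 1) (by omega)
    (F := fun a b => (a : ℝ) * |(b : ℝ) - a|) ((memLp_column d).integrable_mul (memLp_columnJump d))
  simp_rw [integral_const_mul, integral_abs_sub_geomHalf] at h
  rw [integral_mul_meanDist] at h
  exact h

lemma integral_succ_column_mul_columnJump (d : ℕ) :
    ∫ x, (x (d + 1) : ℝ) * columnJump d x ∂geomColumns = 34 / 9 := by
  have e : ∀ x, columnJump d x = |(x d : ℝ) - x (d + 1)| := fun x => abs_sub_comm _ _
  have hi : Integrable (fun x => (x (d + 1) : ℝ) * columnJump d x) geomColumns :=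
    (memLp_column (d + 1)).integrable_mul (memLp_columnJump d)
  simp_rw [e] at hi ⊢
  have h := integral_column_pair (i := d + 1) (j := d) (by omega)
    (F := fun a b => (a : ℝ) * |(b : ℝ) - a|) hi
  simp_rw [integral_const_mul, integral_abs_sub_geomHalf] at h
  rw [integral_mul_meanDist] at h
  exact h

/-- Two successive jumps share a column; integrating the two outer columns first leaves
`meanDist` squared. -/
lemma integral_columnJump_mul_succ (d : ℕ) :
    ∫ x, columnJump d x * columnJump (d + 1) x ∂geomColumns = 158 / 63 := by
  have e : ∀ x, columnJump d x = |(x d : ℝ) - x (d + 1)| := fun x => abs_sub_comm _ _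
  have hi : Integrable (fun x => columnJump d x * columnJump (d + 1) x) geomColumns :=
    (memLp_columnJump d).integrable_mul (memLp_columnJump (d + 1))
  simp_rw [e] at hi ⊢
  have h := integral_column_triple (i := d + 1) (j := d) (k := d + 1 + 1) (by omega) (by omega)
    (by omega) (F := fun a b c => |(b : ℝ) - a| * |(c : ℝ) - a|) hi
  simp_rw [integral_const_mul, integral_mul_const, integral_abs_sub_geomHalf, ← sq] at h
  rw [integral_meanDist_sq] at h
  exact h

lemma covariance_columnJump_succ (d : ℕ) :
    cov[columnJump d, columnJump (d + 1); geomColumns] = 46 / 63 := by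
  rw [covariance_eq_sub (memLp_columnJump d) (memLp_columnJump (d + 1)), integral_columnJump,
    integral_columnJump]
  simp only [Pi.mul_apply]
  rw [integral_columnJump_mul_succ]
  norm_num

lemma covariance_columnJump_of_lt {i j : ℕ} (h : i + 1 < j) :
    cov[columnJump i, columnJump j; geomColumns] = 0 := by
  have hI : IndepFun (columnJump i) (columnJump j) geomColumns :=
    (iIndepFun_columns.indepFun_prodMk_prodMk (fun i => measurable_pi_apply i)
      i (i + 1) j (j + 1) (by omega) (by omega) (by omega) (by omega)).comp
      (φ := fun p : ℕ × ℕ => |(p.2 : ℝ) - p.1|) (ψ := fun p : ℕ × ℕ => |(p.2 : ℝ) - p.1|)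
      Measurable.of_discrete Measurable.of_discrete
  exact hI.covariance_eq_zero (memLp_columnJump i) (memLp_columnJump j)

lemma covariance_columnJump (i j : ℕ) :
    cov[columnJump i, columnJump j; geomColumns] =
      20 / 9 * (if i = j then 1 else 0) + 46 / 63 * (if i + 1 = j then 1 else 0) +
        46 / 63 * (if j + 1 = i then 1 else 0) := by
  rcases lt_trichotomy i j with h | rfl | h
  · rcases Nat.lt_or_ge (i + 1) j with h' | h'
    · rw [covariance_columnJump_of_lt h', if_neg (by omega), if_neg (by omega), if_neg (by omega)]
      norm_num
    · obtain rfl : j = i + 1 := by omega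
      rw [covariance_columnJump_succ, if_neg (by omega), if_pos rfl, if_neg (by omega)]
      norm_num
  · rw [covariance_self (memLp_columnJump i).aestronglyMeasurable.aemeasurable,
      variance_columnJump, if_pos rfl, if_neg (by omega)]
    norm_num
  · rw [covariance_comm]
    rcases Nat.lt_or_ge (j + 1) i with h' | h'
    · rw [covariance_columnJump_of_lt h', if_neg (by omega), if_neg (by omega), if_neg (by omega)]
      norm_num
    · obtain rfl : i = j + 1 := by omega
      rw [covariance_columnJump_succ, if_neg (by omega), if_neg (by omega), if_pos rfl]
      norm_num

lemma covariance_column_columnJump (i j : ℕ) :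
    cov[fun x => (x (i + 1) : ℝ), columnJump j; geomColumns] =
      10 / 9 * (if i = j then 1 else 0) + 10 / 9 * (if i + 1 = j then 1 else 0) := by
  by_cases h₁ : i = j
  · subst h₁
    rw [covariance_eq_sub (memLp_column (i + 1)) (memLp_columnJump i), integral_columnJump,
      integral_column_eq_two]
    simp only [Pi.mul_apply]
    rw [integral_succ_column_mul_columnJump]
    norm_num
  by_cases h₂ : i + 1 = j
  · subst h₂
    rw [covariance_eq_sub (memLp_column (i + 1)) (memLp_columnJump (i + 1)), integral_columnJump,
      integral_column_eq_two]
    simp only [Pi.mul_apply]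
    rw [integral_column_mul_columnJump]
    norm_num
  have hI : IndepFun (columnJump j) (fun x : ℕ → ℕ => (x (i + 1) : ℝ)) geomColumns :=
    (iIndepFun_columns.indepFun_prodMk (fun i => measurable_pi_apply i)
      j (j + 1) (i + 1) (by omega) (by omega)).comp
      (φ := fun p : ℕ × ℕ => |(p.2 : ℝ) - p.1|) (ψ := fun k : ℕ => (k : ℝ))
      Measurable.of_discrete Measurable.of_discrete
  rw [hI.symm.covariance_eq_zero (memLp_column _) (memLp_columnJump _), if_neg h₁, if_neg h₂]
  norm_num

lemma sum_sum_ite_eq (m : ℕ) :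
    ∑ i ∈ Finset.range m, ∑ j ∈ Finset.range m, (if i = j then (1 : ℝ) else 0) = m := by
  rw [Finset.sum_congr rfl fun i hi => by rw [Finset.sum_ite_eq, if_pos hi]]
  simp

lemma sum_sum_ite_succ_eq (m : ℕ) :
    ∑ i ∈ Finset.range (m + 1), ∑ j ∈ Finset.range (m + 1),
      (if i + 1 = j then (1 : ℝ) else 0) = m := by
  rw [Finset.sum_range_succ, Finset.sum_congr rfl (g := fun _ => (1 : ℝ)) fun i hi => by
    rw [Finset.mem_range] at hi
    rw [Finset.sum_ite_eq, if_pos (Finset.mem_range.2 (by omega))]]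
  rw [Finset.sum_ite_eq, if_neg (by simp)]
  simp

lemma variance_sum_columns (s m : ℕ) :
    Var[fun x => ∑ d ∈ Finset.range m, (x (d + s) : ℝ); geomColumns] = 2 * m := by
  rw [← covariance_self
    (memLp_finsetSum _ fun i _ => memLp_column (i + s)).aestronglyMeasurable.aemeasurable,
    covariance_fun_sum_fun_sum' (fun i _ => memLp_column (i + s)) (fun i _ => memLp_column (i + s))]
  have h : ∀ i j : ℕ, cov[fun x => (x (i + s) : ℝ), fun x => (x (j + s) : ℝ); geomColumns] =
      2 * (if i = j then 1 else 0) := by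
    intro i j
    split_ifs with hij
    · rw [hij, covariance_self (memLp_column _).aestronglyMeasurable.aemeasurable, variance_column]
      norm_num
    · rw [covariance_column_of_ne (by omega)]
      norm_num
  simp_rw [h, ← Finset.mul_sum]
  rw [sum_sum_ite_eq]

lemma variance_columnSum (m : ℕ) : Var[columnSum m; geomColumns] = 2 * m :=
  variance_sum_columns 1 m

lemma variance_jumpSum (m : ℕ) :
    Var[jumpSum (m + 1); geomColumns] = 20 / 9 * (m + 1 : ℕ) + 92 / 63 * m := by
  unfold jumpSum
  rw [← covariance_self
    (memLp_finsetSum _ fun i _ => memLp_columnJump i).aestronglyMeasurable.aemeasurable,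
    covariance_fun_sum_fun_sum' (fun i _ => memLp_columnJump i) (fun i _ => memLp_columnJump i)]
  simp_rw [covariance_columnJump, Finset.sum_add_distrib, ← Finset.mul_sum]
  rw [Finset.sum_comm (f := fun i j => if j + 1 = i then (1 : ℝ) else 0), sum_sum_ite_succ_eq,
    sum_sum_ite_eq]
  ring

lemma covariance_columnSum_jumpSum (m : ℕ) :
    cov[columnSum (m + 1), jumpSum (m + 1); geomColumns] =
      10 / 9 * (m + 1 : ℕ) + 10 / 9 * m := by
  unfold columnSum jumpSum
  rw [covariance_fun_sum_fun_sum' (fun i _ => memLp_column (i + 1)) (fun i _ => memLp_columnJump i)]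
  simp_rw [covariance_column_columnJump, Finset.sum_add_distrib, ← Finset.mul_sum]
  rw [sum_sum_ite_succ_eq, sum_sum_ite_eq]

lemma tendsto_affine_div (a b : ℝ) :
    Tendsto (fun m : ℕ => (a * (m + 1 : ℕ) + b * m) / ((m + 1 : ℕ) : ℝ)) atTop (𝓝 (a + b)) := by
  have h := (tendsto_natCast_div_add_atTop (1 : ℝ)).const_mul b
  rw [mul_one] at h
  refine (h.const_add a).congr fun m => ?_
  push_cast
  field_simp

theorem tendsto_integral_jumpSum_div :
    Tendsto (fun m : ℕ => (∫ x, jumpSum m x ∂geomColumns) / m) atTop (𝓝 (4 / 3)) := by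
  refine tendsto_const_nhds.congr' ?_
  filter_upwards [eventually_gt_atTop 0] with m hm
  unfold jumpSum
  rw [integral_finsetSum _ fun i _ => (memLp_columnJump i).integrable (by norm_num)]
  simp_rw [integral_columnJump]
  simp
  field_simp

theorem tendsto_variance_columnSum_div :
    Tendsto (fun m : ℕ => Var[columnSum m; geomColumns] / m) atTop (𝓝 2) := by
  refine tendsto_const_nhds.congr' ?_
  filter_upwards [eventually_gt_atTop 0] with m hm
  rw [variance_columnSum]
  field_simp

theorem tendsto_variance_jumpSum_div :
    Tendsto (fun m : ℕ => Var[jumpSum m; geomColumns] / m) atTop (𝓝 (232 / 63)) := by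
  rw [← tendsto_add_atTop_iff_nat 1]
  simp_rw [variance_jumpSum]
  convert tendsto_affine_div (20 / 9) (92 / 63) using 2
  norm_num

theorem tendsto_covariance_div :
    Tendsto (fun m : ℕ => cov[columnSum m, jumpSum m; geomColumns] / m) atTop (𝓝 (20 / 9)) := by
  rw [← tendsto_add_atTop_iff_nat 1]
  simp_rw [covariance_columnSum_jumpSum]
  convert tendsto_affine_div (10 / 9) (10 / 9) using 2
  norm_num

theorem tendsto_correlation :
    Tendsto (fun m : ℕ => cov[columnSum m, jumpSum m; geomColumns] /
        (√(Var[columnSum m; geomColumns]) * √(Var[jumpSum m; geomColumns])))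
      atTop (𝓝 (5 * √2 * √406 / 174)) := by
  have hlim : (20 / 9 : ℝ) / (√2 * √(232 / 63)) = 5 * √2 * √406 / 174 := by
    rw [← Real.sqrt_mul (by norm_num), div_eq_div_iff (by positivity) (by norm_num), mul_assoc 5,
      ← Real.sqrt_mul (by norm_num), mul_assoc 5, ← Real.sqrt_mul (by norm_num)]
    rw [show (2 * 406 * (2 * (232 / 63)) : ℝ) = (232 / 3) ^ 2 by norm_num,
      Real.sqrt_sq (by norm_num)]
    norm_num
  rw [← hlim]
  refine (tendsto_covariance_div.div (tendsto_variance_columnSum_div.sqrt.mul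
    tendsto_variance_jumpSum_div.sqrt) (by positivity)).congr' ?_
  filter_upwards [eventually_gt_atTop 0] with m hm
  have hm' : (0 : ℝ) < m := by exact_mod_cast hm
  rw [Pi.div_apply, Real.sqrt_div (variance_nonneg _ _), Real.sqrt_div (variance_nonneg _ _),
    div_mul_div_comm, Real.mul_self_sqrt hm'.le, div_div_div_cancel_right₀ hm'.ne']

/-! ### Laws of the first columns -/

open scoped ENNReal in
lemma geomHalf_singleton (k : ℕ) : geomHalf {k} = if k = 0 then 0 else (2⁻¹ : ℝ≥0∞) ^ k := by
  rw [geomHalf, Measure.map_apply Measurable.of_discrete (by measurability)]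
  cases k with
  | zero =>
    have : Nat.succ ⁻¹' {0} = ∅ := by
      ext k
      simp
    rw [this, measure_empty, if_pos rfl]
  | succ k =>
    have : Nat.succ ⁻¹' {k + 1} = {k} := by
      ext j
      simp
    rw [this, geometricMeasure_singleton halfParam_ne_zero, if_neg (by omega),
      show ((1 - (halfParam : ℝ)) ^ k * (halfParam : ℝ)) = (2⁻¹ : ℝ) ^ (k + 1) by
        norm_num [halfParam, pow_succ],
      ENNReal.ofReal_pow (by norm_num), ENNReal.ofReal_inv_of_pos (by norm_num)]
    simp

open scoped ENNReal in
lemma geomColumns_prefix {m : ℕ} (a : Fin m → ℕ) :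
    geomColumns {x | (fun i : Fin m => x i) = a} =
      if ∀ i, a i ≠ 0 then (2⁻¹ : ℝ≥0∞) ^ ∑ i, a i else 0 := by
  have hset : {x : ℕ → ℕ | (fun i : Fin m => x i) = a} =
      Set.pi (Finset.range m : Set ℕ) fun i => if h : i < m then {a ⟨i, h⟩} else ∅ := by
    ext x
    simp only [Set.mem_ofPred_eq, funext_iff, Set.mem_pi, Finset.coe_range, Set.mem_Iio]
    constructor
    · intro h i hi
      rw [dif_pos hi]
      exact h ⟨i, hi⟩
    · intro h i
      have := h i i.2
      rw [dif_pos i.2] at this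
      exact this
  rw [hset, geomColumns, Measure.infinitePi_pi _ fun i _ => MeasurableSet.of_discrete,
    ← Fin.prod_univ_eq_prod_range (fun i => geomHalf (if h : i < m then {a ⟨i, h⟩} else ∅)) m]
  simp only [Fin.is_lt, dite_true, Fin.eta, geomHalf_singleton]
  split_ifs with h
  · rw [← Finset.prod_pow_eq_pow_sum]
    exact Finset.prod_congr rfl fun i _ => if_neg (h i)
  · push Not at h
    obtain ⟨i, hi⟩ := h
    exact Finset.prod_eq_zero (Finset.mem_univ i) (if_pos hi)

open scoped ENNReal in
lemma bargraphLaw_coe_finset {n : ℕ} (s : Finset (Composition n)) :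
    bargraphLaw n s = s.card * (2⁻¹ : ℝ≥0∞) ^ (n - 1) := by
  classical
  rw [bargraphLaw, ← Finset.coe_univ, uniformOn_apply_finset, Finset.univ_inter,
    Finset.card_univ, composition_card, ENNReal.div_eq_inv_mul, mul_comm, Nat.cast_pow,
    ENNReal.inv_pow, Nat.cast_ofNat]

lemma sum_range_getD (l : List ℕ) (k : ℕ) :
    ∑ i ∈ Finset.range k, l.getD i 0 = (l.take k).sum := by
  induction l generalizing k with
  | nil => simp
  | cons x l ih =>
    cases k with
    | zero => simp
    | succ k =>
      rw [Finset.sum_range_succ']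
      simp only [List.getD_cons_succ, List.getD_cons_zero, List.take_succ_cons, List.sum_cons]
      rw [ih, add_comm]

lemma sum_bargraphColumn {n : ℕ} (c : Composition n) {k : ℕ} (hk : c.length ≤ k) :
    ∑ i : Fin k, bargraphColumn c i = n := by
  rw [Fin.sum_univ_eq_sum_range (bargraphColumn c)]
  unfold bargraphColumn
  rw [sum_range_getD, List.take_of_length_le hk, c.blocks_sum]

lemma bargraphColumn_ne_zero {n : ℕ} (c : Composition n) {i : ℕ} (hi : i < c.length) :
    bargraphColumn c i ≠ 0 := by
  rw [bargraphColumn, List.getD_eq_getElem _ _ hi]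
  exact (c.blocks_pos (List.getElem_mem hi)).ne'

lemma take_blocks_eq_ofFn {n k : ℕ} {c : Composition n} {a : Fin k → ℕ} (ha : ∀ i, a i ≠ 0)
    (h : (fun i : Fin k => bargraphColumn c i) = a) : c.blocks.take k = List.ofFn a := by
  have hk : k ≤ c.blocks.length := by
    by_contra hlt
    refine ha ⟨c.blocks.length, not_le.1 hlt⟩ ?_
    rw [← h]
    exact List.getD_eq_default _ _ le_rfl
  refine List.ext_getElem (by simpa using hk) fun i hi hi' => ?_
  have hik : i < k := by simpa using hi'
  rw [List.getElem_take, List.getElem_ofFn]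
  exact (List.getD_eq_getElem _ _ _).symm.trans (congrFun h ⟨i, hik⟩)

/-- The composition with the prescribed positive first parts `a`, continued by `c`. -/
def prependComposition {n k s : ℕ} (a : Fin k → ℕ) (ha : ∀ i, a i ≠ 0) (hs : ∑ i, a i + s = n)
    (c : Composition s) : Composition n where
  blocks := List.ofFn a ++ c.blocks
  blocks_pos := by
    intro i hi
    rcases List.mem_append.1 hi with hi | hi
    · obtain ⟨j, rfl⟩ := List.mem_ofFn.1 hi
      exact Nat.pos_of_ne_zero (ha j)
    · exact c.blocks_pos hi
  blocks_sum := by rw [List.sum_append, List.sum_ofFn, c.blocks_sum, hs]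

lemma prependComposition_injective {n k s : ℕ} (a : Fin k → ℕ) (ha : ∀ i, a i ≠ 0)
    (hs : ∑ i, a i + s = n) : Function.Injective (prependComposition a ha hs) := by
  intro c d h
  ext1
  exact List.append_cancel_left (congrArg Composition.blocks h)

lemma setOf_prefix_eq_range {n k s : ℕ} (a : Fin k → ℕ) (ha : ∀ i, a i ≠ 0)
    (hs : ∑ i, a i + s = n) :
    {c : Composition n | (fun i : Fin k => bargraphColumn c i) = a} =
      Set.range (prependComposition a ha hs) := by
  ext c
  constructor
  · intro h
    have ht := take_blocks_eq_ofFn ha h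
    have hsplit : List.ofFn a ++ c.blocks.drop k = c.blocks := by
      rw [← ht, List.take_append_drop]
    refine ⟨⟨c.blocks.drop k, fun hi => c.blocks_pos (List.mem_of_mem_drop hi), ?_⟩, ?_⟩
    · have hsum := congrArg List.sum hsplit
      rw [List.sum_append, List.sum_ofFn, c.blocks_sum] at hsum
      omega
    · ext1
      exact hsplit
  · rintro ⟨c, rfl⟩
    ext i
    have hi : (i : ℕ) < (List.ofFn a).length := by simp
    rw [bargraphColumn, prependComposition, List.getD_append _ _ _ _ hi,
      List.getD_eq_getElem _ _ hi, List.getElem_ofFn]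

open scoped ENNReal in
/-- A proper initial segment of total area `∑ i, a i < n` has probability `2⁻¹ ^ ∑ i, a i`, as for
independent columns. -/
lemma bargraphLaw_prefix {n k : ℕ} (a : Fin k → ℕ) (hn : ∑ i, a i < n) :
    bargraphLaw n {c | (fun i : Fin k => bargraphColumn c i) = a} =
      if ∀ i, a i ≠ 0 then (2⁻¹ : ℝ≥0∞) ^ ∑ i, a i else 0 := by
  classical
  split_ifs with ha
  · obtain ⟨s, rfl⟩ := Nat.exists_eq_add_of_lt hn
    rw [setOf_prefix_eq_range a ha (s := s + 1) (by omega), ← Set.image_univ, ← Finset.coe_univ,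
      ← Finset.coe_image, bargraphLaw_coe_finset,
      Finset.card_image_of_injective _ (prependComposition_injective a ha _), Finset.card_univ,
      composition_card, Nat.add_sub_cancel, Nat.add_sub_cancel, pow_add, mul_left_comm]
    have : ((2 ^ s : ℕ) : ℝ≥0∞) * 2⁻¹ ^ s = 1 := by
      rw [Nat.cast_pow, ← mul_pow, Nat.cast_ofNat, ENNReal.mul_inv_cancel (by simp) (by simp),
        one_pow]
    rw [this, mul_one]
  · have : {c : Composition n | (fun i : Fin k => bargraphColumn c i) = a} = ∅ := by
      rw [Set.eq_empty_iff_forall_notMem]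
      rintro c rfl
      push Not at ha
      obtain ⟨i, hi⟩ := ha
      have hlen : c.length ≤ k := by
        by_contra hlt
        exact bargraphColumn_ne_zero c (by omega) hi
      exact hn.ne (sum_bargraphColumn c hlen)
    rw [this, measure_empty]

/-! ### Total variation distance of the first columns -/

/-- Two probability measures that agree at the points of `G` differ on any event by at most the
mass of the complement of `G`. -/
lemma abs_measureReal_sub_le {α : Type*} [MeasurableSpace α] [DiscreteMeasurableSpace α]
    [Countable α] {μ ν : Measure α} [IsProbabilityMeasure μ] [IsProbabilityMeasure ν] {G : Set α}
    (h : ∀ a ∈ G, μ {a} = ν {a}) (A : Set α) : |μ.real A - ν.real A| ≤ ν.real Gᶜ := by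
  have hr : μ.restrict G = ν.restrict G := by
    refine Measure.ext_of_singleton fun a => ?_
    rw [Measure.restrict_apply MeasurableSet.of_discrete,
      Measure.restrict_apply MeasurableSet.of_discrete]
    by_cases ha : a ∈ G
    · rw [Set.inter_eq_left.2 (Set.singleton_subset_iff.2 ha), h a ha]
    · rw [Set.singleton_inter_eq_empty.2 ha, measure_empty, measure_empty]
  have hG : ∀ B, μ.real (B ∩ G) = ν.real (B ∩ G) := by
    intro B
    rw [← measureReal_restrict_apply MeasurableSet.of_discrete, hr,
      measureReal_restrict_apply MeasurableSet.of_discrete]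
  have hc : μ.real Gᶜ = ν.real Gᶜ := by
    have := hG Set.univ
    rw [Set.univ_inter] at this
    rw [probReal_compl_eq_one_sub MeasurableSet.of_discrete,
      probReal_compl_eq_one_sub MeasurableSet.of_discrete, this]
  have h1 := measureReal_inter_add_sdiff (μ := μ) (s := A) (t := G) MeasurableSet.of_discrete
  have h2 := measureReal_inter_add_sdiff (μ := ν) (s := A) (t := G) MeasurableSet.of_discrete
  have h3 : μ.real (A \ G) ≤ μ.real Gᶜ := measureReal_mono fun x hx => hx.2
  have h4 : ν.real (A \ G) ≤ ν.real Gᶜ := measureReal_mono fun x hx => hx.2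
  have h5 : 0 ≤ μ.real (A \ G) := measureReal_nonneg
  have h6 : 0 ≤ ν.real (A \ G) := measureReal_nonneg
  have h7 := hG A
  rw [abs_le]
  constructor <;> linarith

lemma measurable_prefix (k : ℕ) : Measurable fun (x : ℕ → ℕ) (i : Fin k) => x i :=
  measurable_pi_lambda _ fun i => measurable_pi_apply (i : ℕ)

/-- The total variation distance of the first `k` columns is at most the probability that `k`
independent columns use up the whole area `n`. -/
lemma abs_prefix_sub_le (n k : ℕ) (A : Set (Fin k → ℕ)) :
    |(bargraphLaw n).real {c | (fun i : Fin k => bargraphColumn c i) ∈ A} -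
      geomColumns.real {x | (fun i : Fin k => x i) ∈ A}| ≤
      geomColumns.real {x | n ≤ ∑ i ∈ Finset.range k, x i} := by
  have hb : Measurable fun (c : Composition n) (i : Fin k) => bargraphColumn c i :=
    Measurable.of_discrete
  have hx := measurable_prefix k
  have := Measure.isProbabilityMeasure_map (μ := bargraphLaw n) hb.aemeasurable
  have := Measure.isProbabilityMeasure_map (μ := geomColumns) hx.aemeasurable
  have h := abs_measureReal_sub_le
    (μ := (bargraphLaw n).map fun c (i : Fin k) => bargraphColumn c i)
    (ν := geomColumns.map fun x (i : Fin k) => x i) (G := {a | ∑ i, a i < n}) (by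
      intro a ha
      rw [Measure.map_apply hb (MeasurableSet.singleton a),
        Measure.map_apply hx (MeasurableSet.singleton a)]
      exact (bargraphLaw_prefix a ha).trans (geomColumns_prefix a).symm) A
  rw [map_measureReal_apply hb MeasurableSet.of_discrete,
    map_measureReal_apply hx MeasurableSet.of_discrete,
    map_measureReal_apply hx MeasurableSet.of_discrete] at h
  refine h.trans (le_of_eq ?_)
  congr 1
  ext x
  simp only [Set.mem_preimage, Set.mem_compl_iff, Set.mem_ofPred_eq, not_lt]
  rw [Fin.sum_univ_eq_sum_range]

lemma measureReal_le_sum_columns_le {n k : ℕ} (h : 2 * k < n) :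
    geomColumns.real {x | n ≤ ∑ i ∈ Finset.range k, x i} ≤
      2 * k / ((n : ℝ) - 2 * k) ^ 2 := by
  have hpos : (0 : ℝ) < n - 2 * k := by
    rw [sub_pos]
    exact_mod_cast h
  have hL : MemLp (fun x : ℕ → ℕ => ∑ d ∈ Finset.range k, (x (d + 0) : ℝ)) 2 geomColumns :=
    memLp_finsetSum _ fun i _ => memLp_column i
  have hc := meas_ge_le_variance_div_sq hL hpos
  rw [variance_sum_columns 0 k] at hc
  have hmean : ∫ x, ∑ d ∈ Finset.range k, (x (d + 0) : ℝ) ∂geomColumns = 2 * k := by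
    rw [integral_finsetSum _ fun i _ => (memLp_column _).integrable (by norm_num)]
    simp_rw [integral_column_eq_two]
    simp [mul_comm]
  rw [hmean] at hc
  refine ENNReal.toReal_le_of_le_ofReal (by positivity) (le_trans (measure_mono ?_) hc)
  intro x hx
  have hx' : (n : ℝ) ≤ ∑ d ∈ Finset.range k, (x d : ℝ) := by exact_mod_cast hx
  simp only [Set.mem_ofPred_eq, add_zero]
  exact le_trans (by linarith) (le_abs_self _)

theorem tendsto_totalVariation_prefix (k : ℕ → ℕ)
    (hk : Tendsto (fun n : ℕ => ((n : ℝ) / 2 - (k n : ℝ)) / √(n : ℝ)) atTop atTop)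
    (ε : ℝ) (hε : 0 < ε) : ∀ᶠ n : ℕ in atTop, ∀ A : Set (Fin (k n) → ℕ),
      |(bargraphLaw n).real {c | (fun i : Fin (k n) => bargraphColumn c i) ∈ A} -
        geomColumns.real {x | (fun i : Fin (k n) => x i) ∈ A}| ≤ ε := by
  filter_upwards [hk.eventually_ge_atTop (max 1 ε⁻¹), eventually_gt_atTop 0] with n hn hn0 A
  refine (abs_prefix_sub_le n (k n) A).trans ?_
  have hn0' : (0 : ℝ) < n := by exact_mod_cast hn0
  have hs : 0 < √(n : ℝ) := Real.sqrt_pos.2 hn0'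
  -- in terms of `y` the Chebyshev bound is at most `n / (2 * y * √n) ^ 2 = 1 / (4 * y ^ 2)`
  set y := ((n : ℝ) / 2 - (k n : ℝ)) / √(n : ℝ) with hy
  have hy1 : 1 ≤ y := (le_max_left _ _).trans hn
  have hyε : ε⁻¹ ≤ y := (le_max_right _ _).trans hn
  have hd : (n : ℝ) - 2 * k n = 2 * y * √(n : ℝ) := by
    rw [hy]
    field_simp
  have hlt : 2 * k n < n := by
    have : (0 : ℝ) < n - 2 * k n := by
      rw [hd]
      positivity
    have : (2 * k n : ℝ) < n := by linarith
    exact_mod_cast this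
  refine (measureReal_le_sum_columns_le hlt).trans ?_
  rw [hd, mul_pow, Real.sq_sqrt hn0'.le, div_le_iff₀ (by positivity)]
  have hle : (2 * k n : ℝ) ≤ n := by exact_mod_cast hlt.le
  have h1 : 1 ≤ ε * y := by
    rw [inv_eq_one_div, div_le_iff₀ hε] at hyε
    linarith
  have h2 : 1 ≤ ε * (2 * y) ^ 2 := by nlinarith
  nlinarith

/-! ### The columns given their number -/

open scoped ENNReal in
/-- Restricted to `m` columns, the law of the bargraph is a multiple of the law of `m` independent
columns restricted to total area `n`. -/
lemma map_restrict_bargraphLaw {n m : ℕ} (hm : 1 ≤ m) :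
    ((bargraphLaw n).restrict {c | c.length = m}).map
        (fun (c : Composition n) (i : Fin m) => bargraphColumn c i) =
      (2 : ℝ≥0∞) • (geomColumns.restrict {x | ∑ i ∈ Finset.range m, x i = n}).map
        (fun (x : ℕ → ℕ) (i : Fin m) => x i) := by
  classical
  refine Measure.ext_of_singleton fun a => ?_
  have hx := measurable_prefix m
  rw [Measure.map_apply Measurable.of_discrete (MeasurableSet.singleton a),
    Measure.restrict_apply MeasurableSet.of_discrete, Measure.smul_apply, smul_eq_mul,
    Measure.map_apply hx (MeasurableSet.singleton a),
    Measure.restrict_apply (hx (MeasurableSet.singleton a))]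
  by_cases ha : ∑ i, a i = n
  · have hr : ((fun (x : ℕ → ℕ) (i : Fin m) => x i) ⁻¹' {a} ∩
        {x | ∑ i ∈ Finset.range m, x i = n}) = {x | (fun i : Fin m => x i) = a} := by
      refine Set.inter_eq_left.2 fun x hxa => ?_
      have hxa' : (fun i : Fin m => x i) = a := hxa
      rw [Set.mem_ofPred_eq, ← Fin.sum_univ_eq_sum_range, ← ha, ← hxa']
    rw [hr, geomColumns_prefix]
    split_ifs with h0
    · have hl : ((fun (c : Composition n) (i : Fin m) => bargraphColumn c i) ⁻¹' {a} ∩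
          {c | c.length = m}) =
          ({prependComposition a h0 (s := 0) (by omega) (Composition.ones 0)} :
            Finset (Composition n)) := by
        ext c
        simp only [Set.mem_inter_iff, Set.mem_preimage, Set.mem_singleton_iff, Set.mem_ofPred_eq,
          Finset.coe_singleton]
        constructor
        · rintro ⟨h1, h2⟩
          have h3 := take_blocks_eq_ofFn h0 h1
          rw [List.take_of_length_le h2.le] at h3
          ext1
          simp [prependComposition, h3]
        · rintro rfl
          refine ⟨?_, by simp [Composition.length, prependComposition]⟩
          have := (setOf_prefix_eq_range a h0 (s := 0) (by omega)).ge
            (Set.mem_range_self (Composition.ones 0))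
          exact this
      rw [hl, bargraphLaw_coe_finset, Finset.card_singleton, Nat.cast_one, one_mul, ha]
      have hn : 1 ≤ n := by
        rw [← ha]
        exact (Nat.one_le_iff_ne_zero.2 (h0 ⟨0, hm⟩)).trans
          (Finset.single_le_sum (f := a) (fun _ _ => Nat.zero_le _) (Finset.mem_univ _))
      obtain ⟨n, rfl⟩ := Nat.exists_eq_add_of_le' hn
      rw [Nat.add_sub_cancel, pow_succ', ← mul_assoc, ENNReal.mul_inv_cancel (by simp) (by simp),
        one_mul]
    · have hl : ((fun (c : Composition n) (i : Fin m) => bargraphColumn c i) ⁻¹' {a} ∩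
          {c | c.length = m}) = ∅ := by
        rw [Set.eq_empty_iff_forall_notMem]
        rintro c ⟨h1, h2⟩
        have h1' : (fun i : Fin m => bargraphColumn c i) = a := h1
        have h2' : c.length = m := h2
        refine h0 fun i => ?_
        rw [← h1']
        exact bargraphColumn_ne_zero c (i.2.trans_eq h2'.symm)
      rw [hl, measure_empty, mul_zero]
  · have hl : ((fun (c : Composition n) (i : Fin m) => bargraphColumn c i) ⁻¹' {a} ∩
        {c | c.length = m}) = ∅ := by
      rw [Set.eq_empty_iff_forall_notMem]
      rintro c ⟨h1, h2⟩
      have h1' : (fun i : Fin m => bargraphColumn c i) = a := h1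
      have h2' : c.length = m := h2
      rw [← h1'] at ha
      exact ha (sum_bargraphColumn c h2'.le)
    have hr : ((fun (x : ℕ → ℕ) (i : Fin m) => x i) ⁻¹' {a} ∩
        {x | ∑ i ∈ Finset.range m, x i = n}) = ∅ := by
      rw [Set.eq_empty_iff_forall_notMem]
      rintro x ⟨h1, h2⟩
      have h1' : (fun i : Fin m => x i) = a := h1
      have h2' : ∑ i ∈ Finset.range m, x i = n := h2
      rw [← Fin.sum_univ_eq_sum_range] at h2'
      rw [← h1'] at ha
      exact ha h2'
    rw [hl, hr, measure_empty, measure_empty, mul_zero]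

open scoped ENNReal in
theorem cond_length_eq_cond_sum {n m : ℕ} (hm : 1 ≤ m) (A : Set (Fin m → ℕ)) :
    (bargraphLaw n)[|{c | c.length = m}] {c | (fun i : Fin m => bargraphColumn c i) ∈ A} =
      geomColumns[|{x | ∑ i ∈ Finset.range m, x i = n}] {x | (fun i : Fin m => x i) ∈ A} := by
  have hx := measurable_prefix m
  have hS : MeasurableSet {x : ℕ → ℕ | ∑ i ∈ Finset.range m, x i = n} := by
    have : Measurable fun x : ℕ → ℕ => ∑ i ∈ Finset.range m, x i :=
      Finset.measurable_sum _ fun i _ => measurable_pi_apply i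
    exact this (MeasurableSet.singleton n)
  have key : ∀ B : Set (Fin m → ℕ),
      bargraphLaw n ({c | c.length = m} ∩ {c | (fun i : Fin m => bargraphColumn c i) ∈ B}) =
        2 * geomColumns ({x | ∑ i ∈ Finset.range m, x i = n} ∩
          {x | (fun i : Fin m => x i) ∈ B}) := by
    intro B
    have h := congrArg (fun μ => μ B) (map_restrict_bargraphLaw (n := n) hm)
    rw [Measure.map_apply Measurable.of_discrete MeasurableSet.of_discrete,
      Measure.restrict_apply MeasurableSet.of_discrete, Measure.smul_apply, smul_eq_mul,
      Measure.map_apply hx MeasurableSet.of_discrete,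
      Measure.restrict_apply (hx MeasurableSet.of_discrete), Set.inter_comm,
      Set.inter_comm _ {x : ℕ → ℕ | _}] at h
    exact h
  have hu := key Set.univ
  simp only [Set.mem_univ, Set.ofPred_true, Set.inter_univ] at hu
  rw [cond_apply MeasurableSet.of_discrete, cond_apply hS, key A, hu,
    ENNReal.mul_inv (by simp) (by simp), mul_mul_mul_comm,
    ENNReal.inv_mul_cancel (by simp) (by simp), one_mul]

/-! ### Asymptotics of uniform bargraphs -/

theorem mainTheorem7 :
    -- given the number of columns: i.i.d. Geometric(1/2) columns conditioned on the area
    (∀ n m : ℕ, 1 ≤ m → m ≤ n → ∀ A : Set (Fin m → ℕ),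
      (bargraphLaw n)[|{c | c.length = m}] {c | (fun i : Fin m => bargraphColumn c i) ∈ A} =
        geomColumns[|{x | ∑ i ∈ Finset.range m, x i = n}]
          {x | (fun i : Fin m => x i) ∈ A}) ∧
    -- without conditioning: convergence in total variation of the first `k n` columns
    (∀ k : ℕ → ℕ, Tendsto (fun n : ℕ => ((n : ℝ) / 2 - (k n : ℝ)) / √(n : ℝ)) atTop atTop →
      ∀ ε > (0 : ℝ), ∀ᶠ n : ℕ in atTop, ∀ A : Set (Fin (k n) → ℕ),
        |(bargraphLaw n).real {c | (fun i : Fin (k n) => bargraphColumn c i) ∈ A} -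
          geomColumns.real {x | (fun i : Fin (k n) => x i) ∈ A}| ≤ ε) ∧
    -- constants of the sequence of i.i.d. Geometric(1/2) columns
    (∀ d, (∫ x, (x d : ℝ) ∂geomColumns) = 2 ∧
      Var[fun x => (x d : ℝ); geomColumns] = 2 ∧
      (∫ x, columnJump d x ∂geomColumns) = 4 / 3 ∧
      Var[columnJump d; geomColumns] = 20 / 9 ∧
      (∫ x, (x (d + 1) : ℝ) * columnJump d x ∂geomColumns) +
        (∫ x, (x d : ℝ) * columnJump d x ∂geomColumns) - 2 * 2 * (4 / 3) = 20 / 9) ∧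
    Tendsto (fun m : ℕ => (∫ x, jumpSum m x ∂geomColumns) / m) atTop (𝓝 (4 / 3)) ∧
    Tendsto (fun m : ℕ => Var[columnSum m; geomColumns] / m) atTop (𝓝 2) ∧
    Tendsto (fun m : ℕ => Var[jumpSum m; geomColumns] / m) atTop (𝓝 (232 / 63)) ∧
    Tendsto (fun m : ℕ => cov[columnSum m, jumpSum m; geomColumns] / m) atTop (𝓝 (20 / 9)) ∧
    Tendsto (fun m : ℕ => cov[columnSum m, jumpSum m; geomColumns] /
        (√(Var[columnSum m; geomColumns]) * √(Var[jumpSum m; geomColumns])))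
      atTop (𝓝 (5 * √2 * √406 / 174)) ∧
    -- the perimeter of a uniform bargraph of area `n`
    (fun n : ℕ => ∫ c, (bargraphPerimeter c : ℝ) ∂(bargraphLaw n))
      ~[atTop] (fun n : ℕ => 5 / 3 * (n : ℝ)) ∧
    (fun n : ℕ => Var[fun c => (bargraphPerimeter c : ℝ); bargraphLaw n])
      ~[atTop] (fun n : ℕ => 173 / 189 * (n : ℝ)) ∧
    TendstoInDistribution
      (fun (n : ℕ) (c : Composition n) =>
        ((bargraphPerimeter c : ℝ) - 5 / 3 * (n : ℝ)) / (√(173 / 189) * √(n : ℝ)))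
      atTop (fun z : ℝ => z) bargraphLaw (gaussianReal 0 1) := by
  exact ⟨fun _ _ hm _ A => cond_length_eq_cond_sum hm A, tendsto_totalVariation_prefix,
    fun d => ⟨integral_column_eq_two d, variance_column d, integral_columnJump d,
      variance_columnJump d, by
        rw [integral_succ_column_mul_columnJump, integral_column_mul_columnJump]
        norm_num⟩,
    tendsto_integral_jumpSum_div, tendsto_variance_columnSum_div, tendsto_variance_jumpSum_div,
    tendsto_covariance_div, tendsto_correlation, integral_bargraphPerimeter_isEquivalent,
    variance_bargraphPerimeter_isEquivalent, tendstoInDistribution_bargraphPerimeter⟩
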